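/- Let $d\ge 2$ be an integer, let $\gamma\in\mathbb R$, and put $c=\gamma-d-1$. For $0<\beta<1$ let $\mathcal R_\beta$ be the operator acting on fields $\vartheta:\mathbb R^d\to\mathbb C^d$ by $$\mathcal R_\beta[\vartheta](\eta)=\beta^c e^{|\eta|^\gamma\left(1-\beta^{-\gamma}\right)}\,\vartheta\!\left(\frac{\eta}{\beta}\right)+i\gamma\int_1^{1/\beta}\frac{e^{|\eta|^\gamma(1-t^\gamma)}}{t^{c}}\int_{\mathbb R^d}\bigl(\eta\cdot\vartheta(\eta t-x)\bigr)\,P_\eta\vartheta(x)\,dx\,dt,$$ where $v\cdot\eta=\sum_j v_j\eta_j$ and $P_\eta v=v-\frac{v\cdot\eta}{|\eta|^2}\,\eta$. For $\nu\in\mathbb R$ let $u_\nu(x)=e^{|x|}|x|^\nu$, and for $p>1$ let $L^p_{u_\nu}$ be the space of measurable fields $f:\mathbb R^d\to\mathbb C^d$ (modulo equality almost everywhere) with $\int_{\mathbb R^d}|f(x)|^p u_\nu(x)^p\,dx<\infty$. Let $\mathfrak{RL}^p_{u_\nu}$ be the set of those $f\in L^p_{u_\nu}$ for which there is a field $\widehat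 f\in L^p_{u_\nu}$, depending on $|x|$ only, such that $|f|\le|\widehat f|$ almost everywhere. **Proposition.** Let $p>1$, $r>1$, $\nu$ and $\kappa$ be real numbers such that $$\frac1r=\frac2p+\frac{2\nu+\kappa}{d}-1,\qquad \kappa<\frac dr,\qquad \frac{d-1}{2}\left(1-\frac2p\right)<\nu<d\,\frac{p-1}{p},\tag{H1}$$ $$2r\ge p,\qquad \max\{\nu,\kappa\}>0,\qquad \nu+\kappa\ge(d-1)\left(\frac1r-\frac1p\right),$$ and $$\max\{0,\;d+p(c+\nu)\}<\frac{d(r-p)}{r}+p(\nu+\kappa+1)<\frac{\gamma p(r-1)}{r}.\tag{H2}$$ Then $\mathfrak{RL}^p_{u_\nu}$ is invariant under $\mathcal R_\beta$ for every $\beta\in(0,1)$: for every $\vartheta\in\mathfrak{RL}^p_{u_\nu}$, the double integral defining $\mathcal R_\beta[\vartheta](\eta)$ converges absolutely for almost every $\eta\in\mathbb R^d$, and $\mathcal R_\beta[\vartheta]\in\mathfrak{RL}^p_{u_\nu}$. -/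

import Mathlib

open MeasureTheory Set

noncomputable section

namespace NSRenorm

/-- The weight `u_ν(x) = e^{|x|} |x|^ν` on `ℝ^d`. -/
def uWeight {d : ℕ} (ν : ℝ) (x : EuclideanSpace ℝ (Fin d)) : ℝ :=
  Real.exp ‖x‖ * ‖x‖ ^ ν

/-- `f` is a measurable field with `∫ |f|^p w^p < ∞`. For fields with values in `ℂ^d ≅ ℝ^{2d}` this
says that each of the `2d` real components lies in the weighted space `L^p_w`. -/
def MemWeightedLp {d : ℕ} (w : EuclideanSpace ℝ (Fin d) → ℝ) (p : ℝ)
    (f : EuclideanSpace ℝ (Fin d) → EuclideanSpace ℂ (Fin d)) : Prop :=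
  AEStronglyMeasurable f volume ∧ MemLp (fun x => w x • f x) (ENNReal.ofReal p) volume

/-- A field that depends on the radial coordinate only. -/
def IsRadialField {d : ℕ} (f : EuclideanSpace ℝ (Fin d) → EuclideanSpace ℂ (Fin d)) : Prop :=
  ∀ x y, ‖x‖ = ‖y‖ → f x = f y

/-- The fields in the weighted `L^p_w` space that are dominated in norm (almost everywhere) by a
radial field of the same weighted space. -/
def radiallyDominated {d : ℕ} (w : EuclideanSpace ℝ (Fin d) → ℝ) (p : ℝ) :
    Set (EuclideanSpace ℝ (Fin d) → EuclideanSpace ℂ (Fin d)) :=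
  {f | MemWeightedLp w p f ∧
    ∃ g : EuclideanSpace ℝ (Fin d) → EuclideanSpace ℂ (Fin d),
      MemWeightedLp w p g ∧ IsRadialField g ∧ ∀ᵐ x ∂volume, ‖f x‖ ≤ ‖g x‖}

/-- The bilinear scalar product `η · v` of a real and a complex vector. -/
def dotC {d : ℕ} (η : EuclideanSpace ℝ (Fin d)) (v : EuclideanSpace ℂ (Fin d)) : ℂ :=
  ∑ i, (η i : ℂ) * v i

/-- The Leray projection `P_η v = v - ((v · η) / |η|²) η` (for `η ≠ 0`). -/
def leray {d : ℕ} (η : EuclideanSpace ℝ (Fin d)) (v : EuclideanSpace ℂ (Fin d)) :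
    EuclideanSpace ℂ (Fin d) :=
  WithLp.toLp 2 fun i => v i - dotC η v / (‖η‖ : ℂ) ^ 2 * (η i : ℂ)

/-- The exponent `c = γ - d - 1`. -/
def cExp (d : ℕ) (γ : ℝ) : ℝ := γ - d - 1

/-- The bilinear integrand `(η · ϑ(tη - x)) P_η ϑ(x)` of the nonlinear term. -/
def bilinearIntegrand {d : ℕ} (ϑ : EuclideanSpace ℝ (Fin d) → EuclideanSpace ℂ (Fin d))
    (η : EuclideanSpace ℝ (Fin d)) (t : ℝ) (x : EuclideanSpace ℝ (Fin d)) :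
    EuclideanSpace ℂ (Fin d) :=
  dotC η (ϑ (t • η - x)) • leray η (ϑ x)

/-- The factor `e^{|η|^γ (1 - t^γ)} / t^c`. -/
def timeFactor {d : ℕ} (γ : ℝ) (η : EuclideanSpace ℝ (Fin d)) (t : ℝ) : ℝ :=
  Real.exp (‖η‖ ^ γ * (1 - t ^ γ)) / t ^ cExp d γ

/-- The renormalization operator
`R_β[ϑ](η) = β^c e^{|η|^γ (1 - 1/β^γ)} ϑ(η/β)
  + i γ ∫_1^{1/β} e^{|η|^γ (1 - t^γ)} / t^c ∫_{ℝ^d} (η · ϑ(ηt - x)) P_η ϑ(x) dx dt`. -/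
def renorm {d : ℕ} (γ β : ℝ) (ϑ : EuclideanSpace ℝ (Fin d) → EuclideanSpace ℂ (Fin d))
    (η : EuclideanSpace ℝ (Fin d)) : EuclideanSpace ℂ (Fin d) :=
  (β ^ cExp d γ * Real.exp (‖η‖ ^ γ * (1 - 1 / β ^ γ))) • ϑ ((1 / β) • η) +
    (Complex.I * (γ : ℂ)) •
      ∫ t in (1 : ℝ)..(1 / β), timeFactor γ η t • ∫ x, bilinearIntegrand ϑ η t x

/-- All integrals in `R_β[ϑ](η)` converge absolutely: the integrand of the nonlinear term is
integrable in `(t, x)` over `(1, 1/β] × ℝ^d`. -/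
def RenormConvergesAt {d : ℕ} (γ β : ℝ)
    (ϑ : EuclideanSpace ℝ (Fin d) → EuclideanSpace ℂ (Fin d))
    (η : EuclideanSpace ℝ (Fin d)) : Prop :=
  Integrable
    (fun q : ℝ × EuclideanSpace ℝ (Fin d) => timeFactor γ η q.1 • bilinearIntegrand ϑ η q.1 q.2)
    ((volume.restrict (Ioc 1 (1 / β))).prod volume)

/-- The operator is well defined on classes of fields modulo equality almost everywhere. -/
theorem renorm_congr_ae {d : ℕ} {γ β : ℝ} (hβ : 0 < β)
    {ϑ ϑ' : EuclideanSpace ℝ (Fin d) → EuclideanSpace ℂ (Fin d)} (h : ϑ =ᵐ[volume] ϑ') :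
    renorm γ β ϑ =ᵐ[volume] renorm γ β ϑ' := by
  have h1 : ∀ᵐ η : EuclideanSpace ℝ (Fin d) ∂volume, ϑ ((1 / β) • η) = ϑ' ((1 / β) • η) :=
    (Measure.quasiMeasurePreserving_smul volume (by positivity : (1 / β : ℝ) ≠ 0)).ae h
  filter_upwards [h1] with η hη
  have h2 : ∀ t : ℝ, ∫ x, bilinearIntegrand ϑ η t x = ∫ x, bilinearIntegrand ϑ' η t x := by
    intro t
    apply integral_congr_ae
    have h3 : ∀ᵐ x : EuclideanSpace ℝ (Fin d) ∂volume, ϑ (t • η - x) = ϑ' (t • η - x) :=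
      (quasiMeasurePreserving_sub_left volume (t • η)).ae h
    filter_upwards [h, h3] with x hx hx'
    simp only [bilinearIntegrand, hx, hx']
  simp only [renorm, hη, h2]

end NSRenorm

end

/-!
Write `d = n + 1` and dominate `|ϑ|` by a radial function `e^{-|x|} F(|x|)`, where the profile
`ρ^m F(ρ)` with `m = ν + n / p` lies in `L^p(0, ∞)`. For `t ≥ 1` the triangle inequality gives
`e^{-|x|} e^{-|tη - x|} ≤ e^{-|η|}`, so the exponential weight factors out of the nonlinear term,
which is at most a constant times `|η| e^{-|η|} ∫ e^{|η|^γ (1 - t^γ)} (F * F)(|η| t) dt`, where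
`F * F` is the radial convolution square on `ℝ^{n+1}`.

In bipolar coordinates `F * F` at distance `s` is an integral over the triangles with sides
`a`, `b`, `s`. For `s` in a fixed shell, say `1 ≤ s ≤ L`, the triangles with a side shorter than `1`
give a weighted fractional integral and the remaining ones a truncated convolution; both map `L^p`
into `L^r` for suitable `r ≥ p`, and scaling transfers the estimate to every shell. Hölder's
inequality in `t` then produces the factor `min(1, |η|^{-γ})^{1 - 1/r}`, because
`e^{|η|^γ (1 - t^γ)}` concentrates near `t = 1`. What is left is an explicit radial majorant,
and (H2) is what puts it in the weighted `L^p` space.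
-/

open scoped ENNReal NNReal

namespace NSRenorm

section Young

variable {α β : Type*} [MeasurableSpace α] [MeasurableSpace β] {μ : Measure α} {ν : Measure β}

theorem eLpNorm'_mono_ennreal {f g : α → ℝ≥0∞} {q : ℝ} (hq : 0 ≤ q) (hfg : ∀ x, f x ≤ g x) :
    eLpNorm' f q μ ≤ eLpNorm' g q μ :=
  eLpNorm'_mono_enorm_ae hq (.of_forall hfg)

theorem lintegral_rpow_eq_rpow_eLpNorm' (f : α → ℝ≥0∞) {q : ℝ} (hq : 0 < q) :
    ∫⁻ x, f x ^ q ∂μ = eLpNorm' f q μ ^ q :=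
  lintegral_rpow_enorm_eq_rpow_eLpNorm' (f := f) hq

theorem eLpNorm'_le_iff_lintegral_rpow_le {f : α → ℝ≥0∞} {q : ℝ} (hq : 0 < q) {C : ℝ≥0∞} :
    eLpNorm' f q μ ≤ C ↔ ∫⁻ x, f x ^ q ∂μ ≤ C ^ q := by
  rw [lintegral_rpow_eq_rpow_eLpNorm' f hq, ENNReal.rpow_le_rpow_iff hq]

theorem lintegral_rpow_mul_rpow_mul_rpow_le {f g h : α → ℝ≥0∞} (hf : Measurable f)
    (hg : Measurable g) (hh : Measurable h) {a b c : ℝ} (ha : 0 ≤ a) (hb : 0 ≤ b) (hc : 0 ≤ c)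
    (habc : a + b + c = 1) :
    ∫⁻ x, f x ^ a * g x ^ b * h x ^ c ∂μ ≤
      (∫⁻ x, f x ∂μ) ^ a * (∫⁻ x, g x ∂μ) ^ b * (∫⁻ x, h x ∂μ) ^ c := by
  have hmeas : ∀ i ∈ Finset.univ, AEMeasurable (![f, g, h] i) μ := by
    simp [Fin.forall_fin_succ, hf.aemeasurable, hg.aemeasurable, hh.aemeasurable]
  have holder := ENNReal.lintegral_prod_norm_pow_le Finset.univ hmeas (p := ![a, b, c])
    (by simp [Fin.sum_univ_three, habc]) (by simp [Fin.forall_fin_succ, ha, hb, hc])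
  simpa [Fin.prod_univ_three] using holder

theorem lintegral_mul_rpow_le_of_young {k f : α → ℝ≥0∞} (hk : Measurable k) (hf : Measurable f)
    {p q m : ℝ} (hp : 1 ≤ p) (hpq : p ≤ q) (hm : 0 < m) (hmpq : 1 / q + (1 - 1 / p) = 1 / m) :
    (∫⁻ a, k a * f a ∂μ) ^ q ≤
      (∫⁻ a, k a ^ m * f a ^ p ∂μ) * eLpNorm' f p μ ^ (q - p) * eLpNorm' k m μ ^ (q - m) := by
  have hp0 : 0 < p := by linarith
  have hq0 : 0 < q := by linarith
  have hp_inv : 1 / p ≤ 1 := (div_le_one hp0).2 hp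
  have hq_inv : 1 / q ≤ 1 / p := one_div_le_one_div_of_le hp0 hpq
  have hm_exp : m * (1 - 1 / p) * q = q - m := by
    field_simp at hmpq ⊢
    linear_combination hmpq
  have split_integrand : ∀ a, k a * f a =
      (k a ^ m * f a ^ p) ^ (1 / q) * (f a ^ p) ^ (1 / p - 1 / q) * (k a ^ m) ^ (1 - 1 / p) := by
    intro a
    rw [ENNReal.mul_rpow_of_nonneg _ _ (by positivity : 0 ≤ 1 / q)]
    simp only [← ENNReal.rpow_mul]
    rw [mul_assoc (k a ^ _), ← ENNReal.rpow_add_of_nonneg _ _ (by positivity)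
        (mul_nonneg hp0.le (by linarith)), mul_right_comm,
      ← ENNReal.rpow_add_of_nonneg _ _ (by positivity) (mul_nonneg hm.le (by linarith)),
      ← mul_add, ← mul_add, hmpq, mul_one_div_cancel hm.ne', add_sub_cancel,
      mul_one_div_cancel hp0.ne', ENNReal.rpow_one, ENNReal.rpow_one]
  calc (∫⁻ a, k a * f a ∂μ) ^ q
      ≤ ((∫⁻ a, k a ^ m * f a ^ p ∂μ) ^ (1 / q) * (∫⁻ a, f a ^ p ∂μ) ^ (1 / p - 1 / q) *
          (∫⁻ a, k a ^ m ∂μ) ^ (1 - 1 / p)) ^ q := by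
        simp_rw [split_integrand]
        gcongr
        exact lintegral_rpow_mul_rpow_mul_rpow_le ((hk.pow_const m).mul (hf.pow_const p))
          (hf.pow_const p) (hk.pow_const m) (by positivity) (by linarith) (by linarith) (by ring)
    _ = _ := by
        rw [lintegral_rpow_eq_rpow_eLpNorm' f hp0, lintegral_rpow_eq_rpow_eLpNorm' k hm,
          ENNReal.mul_rpow_of_nonneg _ _ hq0.le, ENNReal.mul_rpow_of_nonneg _ _ hq0.le]
        simp only [← ENNReal.rpow_mul]
        rw [one_div_mul_cancel hq0.ne', ENNReal.rpow_one, hm_exp,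
          show p * (1 / p - 1 / q) * q = q - p by field_simp]

theorem eLpNorm'_lintegral_mul_le [SFinite μ] [SFinite ν]
    {k : β → α → ℝ≥0∞} {f : α → ℝ≥0∞} (hk : Measurable (Function.uncurry k)) (hf : Measurable f)
    {p q m : ℝ} (hp : 1 ≤ p) (hpq : p ≤ q) (hm : 0 < m) (hmpq : 1 / q + (1 - 1 / p) = 1 / m)
    {K : ℝ≥0∞} (hleft : ∀ a, eLpNorm' (fun u => k u a) m ν ≤ K)
    (hright : ∀ u, eLpNorm' (k u) m μ ≤ K) :
    eLpNorm' (fun u => ∫⁻ a, k u a * f a ∂μ) q ν ≤ K * eLpNorm' f p μ := by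
  have hp0 : 0 < p := by linarith
  have hq0 : 0 < q := by linarith
  have hmq : m ≤ q := by
    rw [← one_div_le_one_div hq0 hm, ← hmpq]
    linarith [(div_le_one hp0).2 hp]
  have hkf : Measurable fun z : β × α => k z.1 z.2 ^ m * f z.2 ^ p :=
    (hk.pow_const m).mul ((hf.pow_const p).comp measurable_snd)
  have tonelli : ∫⁻ u, ∫⁻ a, k u a ^ m * f a ^ p ∂μ ∂ν ≤ K ^ m * eLpNorm' f p μ ^ p := by
    rw [lintegral_lintegral_swap hkf.aemeasurable, ← lintegral_rpow_eq_rpow_eLpNorm' f hp0,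
      ← lintegral_const_mul _ (hf.pow_const p)]
    refine lintegral_mono fun a => ?_
    have hka : Measurable fun u => k u a := hk.comp measurable_prodMk_right
    rw [lintegral_mul_const _ (hka.pow_const m), lintegral_rpow_eq_rpow_eLpNorm' _ hm]
    gcongr
    exact hleft a
  refine (eLpNorm'_le_iff_lintegral_rpow_le hq0).2 ?_
  calc ∫⁻ u, (∫⁻ a, k u a * f a ∂μ) ^ q ∂ν
      ≤ ∫⁻ u, (∫⁻ a, k u a ^ m * f a ^ p ∂μ) * (eLpNorm' f p μ ^ (q - p) * K ^ (q - m)) ∂ν := by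
        refine lintegral_mono fun u => ?_
        have hku : Measurable (k u) := hk.comp measurable_prodMk_left
        refine (lintegral_mul_rpow_le_of_young hku hf hp hpq hm hmpq).trans ?_
        rw [mul_assoc]
        gcongr
        exact hright u
    _ ≤ (K ^ m * eLpNorm' f p μ ^ p) * (eLpNorm' f p μ ^ (q - p) * K ^ (q - m)) := by
        rw [lintegral_mul_const _ hkf.lintegral_prod_right']
        gcongr
    _ = K ^ (m + (q - m)) * eLpNorm' f p μ ^ (p + (q - p)) := by
        rw [ENNReal.rpow_add_of_nonneg _ _ hm.le (by linarith),
          ENNReal.rpow_add_of_nonneg _ _ hp0.le (by linarith)]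
        ring
    _ = (K * eLpNorm' f p μ) ^ q := by
        rw [add_sub_cancel, add_sub_cancel, ENNReal.mul_rpow_of_nonneg _ _ hq0.le]

end Young

section TruncatedPowers

/-- The function `v ↦ v ^ q` on `(0, T)`, extended by zero. -/
noncomputable def truncPow (q T : ℝ) : ℝ → ℝ≥0∞ :=
  (Ioo 0 T).indicator fun v => ENNReal.ofReal (v ^ q)

theorem truncPow_of_mem {q T v : ℝ} (hv : v ∈ Ioo 0 T) :
    truncPow q T v = ENNReal.ofReal (v ^ q) :=
  indicator_of_mem hv _

theorem measurable_truncPow (q T : ℝ) : Measurable (truncPow q T) :=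
  Measurable.indicator (by fun_prop) measurableSet_Ioo

theorem truncPow_rpow {q T m : ℝ} (hm : 0 < m) (v : ℝ) :
    truncPow q T v ^ m = truncPow (q * m) T v := by
  by_cases hv : v ∈ Ioo 0 T
  · rw [truncPow_of_mem hv, truncPow_of_mem hv, Real.rpow_mul hv.1.le,
      ENNReal.ofReal_rpow_of_nonneg (Real.rpow_nonneg hv.1.le _) hm.le]
  · simp only [truncPow, indicator_of_notMem hv, ENNReal.zero_rpow_of_pos hm]

theorem lintegral_truncPow_ne_top {q : ℝ} (hq : -1 < q) (T : ℝ) : ∫⁻ v, truncPow q T v ≠ ⊤ := by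
  have hint : IntegrableOn (fun v : ℝ => v ^ q) (Ioo 0 T) :=
    (intervalIntegral.intervalIntegrable_rpow' hq).1.mono_set Ioo_subset_Ioc_self
  rw [truncPow, lintegral_indicator measurableSet_Ioo]
  exact hint.lintegral_lt_top.ne

theorem eLpNorm'_truncPow_ne_top {q m : ℝ} (hm : 0 < m) (hq : -1 < q * m) (T : ℝ) :
    eLpNorm' (truncPow q T) m volume ≠ ⊤ := by
  refine ENNReal.rpow_ne_top_of_nonneg (by positivity) ?_
  simp only [enorm_eq_self, truncPow_rpow hm]
  exact lintegral_truncPow_ne_top hq T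

/-- The power `a ^ (-σ)` on `[1, ∞)`, extended by zero. -/
noncomputable def tailPow (σ : ℝ) : ℝ → ℝ≥0∞ :=
  (Ici 1).indicator fun a => ENNReal.ofReal (a ^ (-σ))

theorem tailPow_of_mem {σ a : ℝ} (ha : a ∈ Ici 1) : tailPow σ a = ENNReal.ofReal (a ^ (-σ)) :=
  indicator_of_mem ha _

theorem measurable_tailPow (σ : ℝ) : Measurable (tailPow σ) :=
  Measurable.indicator (by fun_prop) measurableSet_Ici

theorem tailPow_le_one {σ : ℝ} (hσ : 0 ≤ σ) (a : ℝ) : tailPow σ a ≤ 1 :=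
  indicator_le' (fun _ ha => ENNReal.ofReal_le_one.2
    (Real.rpow_le_one_of_one_le_of_nonpos ha (by linarith))) (fun _ _ => zero_le_one) a

theorem lintegral_tailPow_ne_top {σ : ℝ} (hσ : 1 < σ) : ∫⁻ a, tailPow σ a ≠ ⊤ := by
  have hint : IntegrableOn (fun v : ℝ => v ^ (-σ)) (Ioi 1) :=
    integrableOn_Ioi_rpow_of_lt (by linarith) one_pos
  rw [tailPow, lintegral_indicator measurableSet_Ici, ← restrict_Ioi_eq_restrict_Ici]
  exact hint.lintegral_lt_top.ne

theorem tailPow_le_rpow {σ σ' θ : ℝ} (hθ : 0 ≤ θ) (h : σ' * θ ≤ σ) (a : ℝ) :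
    tailPow σ a ≤ tailPow σ' a ^ θ := by
  by_cases ha : a ∈ Ici (1 : ℝ)
  · have ha0 : 0 ≤ a := zero_le_one.trans ha
    rw [tailPow_of_mem ha, tailPow_of_mem ha,
      ENNReal.ofReal_rpow_of_nonneg (by positivity) hθ, ← Real.rpow_mul ha0]
    exact ENNReal.ofReal_le_ofReal (Real.rpow_le_rpow_of_exponent_le ha (by linarith))
  · rw [tailPow, indicator_of_notMem ha]
    exact zero_le

end TruncatedPowers

section ShortSide

/-- The kernel `a ^ (e + l) (a - u) ^ (-l)` on `0 ≤ u < a < 1` of a weighted fractional integral. -/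
noncomputable def weylKernel (l e u a : ℝ) : ℝ≥0∞ :=
  if 0 ≤ u ∧ u < a ∧ a < 1 then ENNReal.ofReal (a ^ (e + l) * (a - u) ^ (-l)) else 0

theorem measurable_weylKernel (l e : ℝ) : Measurable (Function.uncurry (weylKernel l e)) := by
  unfold weylKernel Function.uncurry
  refine Measurable.ite ?_ (by fun_prop) measurable_const
  exact (measurableSet_le measurable_const measurable_fst).inter
    ((measurableSet_lt measurable_fst measurable_snd).inter
      (measurableSet_lt measurable_snd measurable_const))

theorem weylKernel_eq_mul_truncPow (l e δ u a : ℝ) :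
    weylKernel l e u a = weylKernel l (e - δ) u a * truncPow δ 1 a := by
  unfold weylKernel
  split_ifs with h
  · have ha : 0 < a := h.1.trans_lt h.2.1
    have hau : 0 < a - u := by linarith [h.2.1]
    rw [truncPow_of_mem ⟨ha, h.2.2⟩, ← ENNReal.ofReal_mul (by positivity), mul_right_comm,
      ← Real.rpow_add ha]
    ring_nf
  · simp

theorem weylKernel_le (l e u a : ℝ) :
    weylKernel l e u a ≤ (truncPow (-l) 1 + truncPow e 1) (a - u) := by
  unfold weylKernel
  split_ifs with h
  · have ha : 0 < a := h.1.trans_lt h.2.1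
    have hau : 0 < a - u := by linarith [h.2.1]
    have hmem : a - u ∈ Ioo 0 1 := ⟨hau, by linarith⟩
    rw [Pi.add_apply, truncPow_of_mem hmem, truncPow_of_mem hmem,
      ← ENNReal.ofReal_add (by positivity) (by positivity)]
    apply ENNReal.ofReal_le_ofReal
    rcases le_total 0 (e + l) with hel | hel
    · calc a ^ (e + l) * (a - u) ^ (-l) ≤ 1 * (a - u) ^ (-l) := by
            gcongr
            exact Real.rpow_le_one ha.le h.2.2.le hel
        _ ≤ _ := by rw [one_mul]; exact le_add_of_nonneg_right (by positivity)
    · calc a ^ (e + l) * (a - u) ^ (-l) ≤ (a - u) ^ (e + l) * (a - u) ^ (-l) := by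
            gcongr ?_ * _
            exact Real.rpow_le_rpow_of_nonpos hau (by linarith) hel
        _ = (a - u) ^ e := by rw [← Real.rpow_add hau]; ring_nf
        _ ≤ _ := le_add_of_nonneg_left (by positivity)
  · exact zero_le

theorem exists_eLpNorm'_weylKernel_le {l e m : ℝ} (hm : 1 ≤ m) (hl : -1 < -l * m)
    (he : -1 < e * m) :
    ∃ K : ℝ≥0, (∀ a, eLpNorm' (fun u => weylKernel l e u a) m volume ≤ K) ∧
      ∀ u, eLpNorm' (weylKernel l e u) m volume ≤ K := by
  have hm0 : 0 < m := by linarith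
  set g := truncPow (-l) 1 + truncPow e 1
  have hg : eLpNorm' g m volume ≠ ⊤ := ne_top_of_le_ne_top
    (ENNReal.add_ne_top.2 ⟨eLpNorm'_truncPow_ne_top hm0 hl 1, eLpNorm'_truncPow_ne_top hm0 he 1⟩)
    (eLpNorm'_add_le (measurable_truncPow _ _).aestronglyMeasurable
      (measurable_truncPow _ _).aestronglyMeasurable hm)
  lift eLpNorm' g m volume to ℝ≥0 using hg with K hK
  refine ⟨K, fun a => ?_, fun u => ?_⟩
  · calc _ ≤ eLpNorm' (fun u => g (a - u)) m volume :=
          eLpNorm'_mono_ennreal hm0.le fun u => weylKernel_le l e u a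
      _ = K := by
          rw [hK, eLpNorm', eLpNorm', lintegral_sub_left_eq_self fun u => ‖g u‖ₑ ^ m]
  · calc _ ≤ eLpNorm' (fun a => g (a - u)) m volume :=
          eLpNorm'_mono_ennreal hm0.le (weylKernel_le l e u)
      _ = K := by
          rw [hK, eLpNorm', eLpNorm', lintegral_sub_right_eq_self fun u => ‖g u‖ₑ ^ m]

theorem exists_eLpNorm'_truncPow_mul_le {p q δ : ℝ} (hq : 0 < q) (hqp : q < p)
    (hδ : 1 / p - 1 / q < δ) (T : ℝ) :
    ∃ C : ℝ≥0, ∀ w : ℝ → ℝ≥0∞, Measurable w →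
      eLpNorm' (truncPow δ T * w) q volume ≤ C * eLpNorm' w p volume := by
  have hgap : 0 < 1 / q - 1 / p := sub_pos.2 (one_div_lt_one_div_of_lt hq hqp)
  have hδ' : -1 < δ * (1 / (1 / q - 1 / p)) := by
    rw [mul_one_div, lt_div_iff₀ hgap]
    linarith
  lift eLpNorm' (truncPow δ T) (1 / (1 / q - 1 / p)) volume to ℝ≥0
    using eLpNorm'_truncPow_ne_top (by positivity) hδ' T with C hC
  refine ⟨C, fun w hw => ?_⟩
  rw [hC, mul_comm (truncPow δ T), mul_comm (eLpNorm' _ _ _)]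
  exact ENNReal.lintegral_Lp_mul_le_Lq_mul_Lr hq hqp
    (by rw [one_div_one_div (1 / q - 1 / p)]; ring) volume hw.aemeasurable
    (measurable_truncPow δ T).aemeasurable

/-- For `q < p` part of the weight of the kernel is spent on passing from `L^p` to `L^q`. -/
theorem exists_eLpNorm'_lintegral_weylKernel_mul_le {p q l e : ℝ} (hp : 1 < p) (hq : 1 ≤ q)
    (hl1 : l < 1) (hl : l < 1 / q + (1 - 1 / p)) (he : 0 < e + (1 / q + (1 - 1 / p))) :
    ∃ C : ℝ≥0, ∀ w : ℝ → ℝ≥0∞, Measurable w →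
      eLpNorm' (fun u => ∫⁻ a, weylKernel l e u a * w a) q volume ≤ C * eLpNorm' w p volume := by
  have hq0 : 0 < q := by linarith
  have hp0 : 0 < p := by linarith
  have hp_inv : 1 / p < 1 := (div_lt_one hp0).2 hp
  have hq_inv : 0 < 1 / q := by positivity
  rcases le_or_gt p q with hpq | hqp
  · set τ : ℝ := 1 / q + (1 - 1 / p)
    have hτ0 : 0 < τ := by linarith
    have hτ1 : τ ≤ 1 := by linarith [one_div_le_one_div_of_le hp0 hpq]
    obtain ⟨K, hleft, hright⟩ := exists_eLpNorm'_weylKernel_le (l := l) (e := e) (m := 1 / τ)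
      ((one_le_div hτ0).2 hτ1) (by rw [mul_one_div, lt_div_iff₀ hτ0]; linarith)
      (by rw [mul_one_div, lt_div_iff₀ hτ0]; linarith)
    exact ⟨K, fun w hw => eLpNorm'_lintegral_mul_le (measurable_weylKernel l e) hw hp.le hpq
      (by positivity) (one_div_one_div τ).symm hleft hright⟩
  · obtain ⟨δ, hδ, hδe⟩ := exists_between (show 1 / p - 1 / q < e + 1 by linarith)
    obtain ⟨C, hC⟩ := exists_eLpNorm'_truncPow_mul_le hq0 hqp hδ 1
    obtain ⟨K, hleft, hright⟩ := exists_eLpNorm'_weylKernel_le (l := l) (e := e - δ) le_rfl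
      (by linarith) (by linarith)
    refine ⟨K * C, fun w hw => ?_⟩
    have young := eLpNorm'_lintegral_mul_le (measurable_weylKernel l (e - δ))
      ((measurable_truncPow δ 1).mul hw) hq le_rfl one_pos (by ring) hleft hright
    simp only [Pi.mul_apply, ← mul_assoc, ← weylKernel_eq_mul_truncPow] at young
    rw [ENNReal.coe_mul, mul_assoc]
    exact young.trans (by gcongr; exact hC w hw)

theorem lintegral_comp_abs_sub_le {g : ℝ → ℝ≥0∞} (hg : Measurable g) (c : ℝ) :
    ∫⁻ v, g |v - c| ≤ 2 * ∫⁻ v, g v := by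
  calc ∫⁻ v, g |v - c| ≤ ∫⁻ v, (g (v - c) + g (c - v)) := by
        refine lintegral_mono fun v => ?_
        rcases abs_choice (v - c) with h | h
        · rw [h]
          exact le_self_add
        · rw [h, neg_sub]
          exact le_add_self
    _ = _ := by
        have hgc : Measurable fun v => g (v - c) := hg.comp (measurable_id.sub_const c)
        rw [lintegral_add_left hgc, lintegral_sub_right_eq_self, lintegral_sub_left_eq_self,
          two_mul]

theorem eLpNorm'_comp_abs_sub_le {g : ℝ → ℝ≥0∞} (hg : Measurable g) {q : ℝ} (hq : 0 < q) (c : ℝ) :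
    eLpNorm' (fun v => g |v - c|) q volume ≤ 2 ^ (1 / q) * eLpNorm' g q volume := by
  rw [eLpNorm'_le_iff_lintegral_rpow_le hq, ENNReal.mul_rpow_of_nonneg _ _ hq.le,
    ← ENNReal.rpow_mul, one_div_mul_cancel hq.ne', ENNReal.rpow_one,
    ← lintegral_rpow_eq_rpow_eLpNorm' g hq]
  exact lintegral_comp_abs_sub_le (hg.pow_const q) c

/-- The part of the triangle integral with side `a < 1`, in terms of `w b = b ^ m F b`. -/
noncomputable def shortSide (l e : ℝ) (w : ℝ → ℝ≥0∞) (s : ℝ) : ℝ≥0∞ :=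
  ∫⁻ b, (∫⁻ a, weylKernel l e |s - b| a * w a) * w b

theorem exists_eLpNorm'_shortSide_le {p r l e : ℝ} (hp : 1 < p) (hpr : p ≤ r)
    (hl1 : l < 1) (hl : l < 2 + 1 / r - 2 / p) (he : 0 < e + (2 + 1 / r - 2 / p)) :
    ∃ C : ℝ≥0, ∀ w : ℝ → ℝ≥0∞, Measurable w →
      eLpNorm' (shortSide l e w) r volume ≤ C * eLpNorm' w p volume ^ 2 := by
  have hp0 : 0 < p := by linarith
  have hp_inv : 1 / p < 1 := (div_lt_one hp0).2 hp
  have hr_inv : 1 / r ≤ 1 / p := one_div_le_one_div_of_le hp0 hpr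
  have hr_inv_pos : 0 < 1 / r := one_div_pos.2 (by linarith)
  set q : ℝ := 1 / (1 / r + (1 - 1 / p))
  have hq_inv : 1 / q = 1 / r + (1 - 1 / p) := one_div_one_div _
  have hq1 : 1 ≤ q := (one_le_div (by linarith)).2 (by linarith)
  have hq0 : 0 < q := by linarith
  have hexp : 1 / q + (1 - 1 / p) = 2 + 1 / r - 2 / p := by rw [hq_inv]; ring
  obtain ⟨C, hC⟩ := exists_eLpNorm'_lintegral_weylKernel_mul_le hp hq1 hl1
    (hexp ▸ hl) (hexp ▸ he)
  refine ⟨2 ^ (1 / q) * C, fun w hw => ?_⟩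
  set Φ : ℝ → ℝ≥0∞ := fun u => ∫⁻ a, weylKernel l e u a * w a
  have hΦ : Measurable Φ := ((measurable_weylKernel l e).mul
    (hw.comp measurable_snd)).lintegral_prod_right'
  have hmarginal : ∀ c, eLpNorm' (fun v => Φ |v - c|) q volume ≤
      2 ^ (1 / q) * (C * eLpNorm' w p volume) := fun c =>
    (eLpNorm'_comp_abs_sub_le hΦ hq0 c).trans (by gcongr; exact hC w hw)
  have young := eLpNorm'_lintegral_mul_le (k := fun s b => Φ |s - b|) (hΦ.comp (by fun_prop)) hw
    hp.le hpr hq0 hq_inv.symm hmarginal fun s => by simpa only [abs_sub_comm] using hmarginal s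
  refine young.trans_eq ?_
  rw [ENNReal.coe_mul, ENNReal.coe_rpow_of_nonneg _ (by positivity), ENNReal.coe_ofNat]
  ring

end ShortSide

section LongSide

theorem eLpNorm'_comp_add_mul {w : ℝ → ℝ≥0∞} {p c : ℝ} (hc : |c| = 1) (v : ℝ) :
    eLpNorm' (fun a => w (v + c * a)) p volume = eLpNorm' w p volume := by
  rcases (abs_eq zero_le_one).1 hc with rfl | rfl
  · simp only [eLpNorm', one_mul, lintegral_add_left_eq_self (fun a => ‖w a‖ₑ ^ p) v]
  · simp only [eLpNorm', neg_mul, one_mul, ← sub_eq_add_neg,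
      lintegral_sub_left_eq_self (fun a => ‖w a‖ₑ ^ p) v]

theorem exists_lintegral_tailPow_mul_le {p σ : ℝ} (hp : 2 ≤ p) (hσ0 : 0 ≤ σ)
    (hσ : 1 - 2 / p < σ) :
    ∃ C : ℝ≥0, ∀ f g : ℝ → ℝ≥0∞, Measurable f → Measurable g →
      ∫⁻ a, tailPow σ a * (f a * g a) ≤ C * (eLpNorm' f p volume * eLpNorm' g p volume) := by
  have hp0 : 0 < p := by linarith
  have hθ : 0 ≤ 1 - 2 / p := sub_nonneg.2 ((div_le_one hp0).2 hp)
  obtain ⟨σ', hσ'1, hσ'σ⟩ : ∃ σ', 1 < σ' ∧ σ' * (1 - 2 / p) ≤ σ := by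
    rcases hθ.eq_or_lt with h | h
    · exact ⟨2, one_lt_two, by rw [← h]; simpa⟩
    · exact ⟨σ / (1 - 2 / p), by rwa [one_lt_div h], by rw [div_mul_cancel₀ _ h.ne']⟩
  lift (∫⁻ a, tailPow σ' a) ^ (1 - 2 / p) to ℝ≥0
    using ENNReal.rpow_ne_top_of_nonneg hθ (lintegral_tailPow_ne_top hσ'1) with C hC
  refine ⟨C, fun f g hf hg => ?_⟩
  have holder := lintegral_rpow_mul_rpow_mul_rpow_le (μ := volume) (measurable_tailPow σ')
    (hf.pow_const p) (hg.pow_const p) hθ (by positivity : 0 ≤ 1 / p) (by positivity : 0 ≤ 1 / p)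
    (by ring)
  rw [mul_assoc, ← hC] at holder
  refine (lintegral_mono fun a => ?_).trans holder
  rw [← ENNReal.rpow_mul, ← ENNReal.rpow_mul, mul_one_div_cancel hp0.ne', ENNReal.rpow_one,
    ENNReal.rpow_one, mul_assoc]
  gcongr
  exact tailPow_le_rpow hθ hσ'σ a

theorem exists_eLpNorm'_truncPow_abs_sub_le {l m : ℝ} (hm : 0 < m) (hl : -1 < -l * m) (T : ℝ) :
    ∃ K : ℝ≥0, ∀ c, eLpNorm' (fun v => truncPow (-l) T |v - c|) m volume ≤ K := by
  lift 2 ^ (1 / m) * eLpNorm' (truncPow (-l) T) m volume to ℝ≥0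
    using ENNReal.mul_ne_top (by simp) (eLpNorm'_truncPow_ne_top hm hl T) with K hK
  exact ⟨K, fun c => hK ▸ eLpNorm'_comp_abs_sub_le (measurable_truncPow _ _) hm c⟩

/-- For `c = ±1`, the part of the triangle integral with side `a ≥ 1`, in terms of
`w b = b ^ m F b` and of the variable `v = b - c a`. -/
noncomputable def longSide (l T σ c : ℝ) (w : ℝ → ℝ≥0∞) (s : ℝ) : ℝ≥0∞ :=
  ∫⁻ v, truncPow (-l) T |s - v| * ∫⁻ a, tailPow σ a * (w a * w (v + c * a))

variable {w : ℝ → ℝ≥0∞}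

theorem measurable_tailPow_mul_mul (σ c : ℝ) (hw : Measurable w) :
    Measurable (Function.uncurry fun v a : ℝ => tailPow σ a * (w a * w (v + c * a))) :=
  ((measurable_tailPow σ).comp measurable_snd).mul
    ((hw.comp measurable_snd).mul (hw.comp (by fun_prop)))

theorem measurable_longSide (l T σ c : ℝ) (hw : Measurable w) :
    Measurable (longSide l T σ c w) := by
  have h : Measurable fun z : ℝ × ℝ => truncPow (-l) T |z.1 - z.2| *
      ∫⁻ a, tailPow σ a * (w a * w (z.2 + c * a)) :=
    ((measurable_truncPow _ _).comp (by fun_prop)).mul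
      ((measurable_tailPow_mul_mul σ c hw).lintegral_prod_right'.comp measurable_snd)
  exact h.lintegral_prod_right'

theorem exists_eLpNorm'_longSide_le_of_two_le {p r l σ c : ℝ} (hp : 2 ≤ p) (hr : 0 < r)
    (hl1 : l < 1) (hσ0 : 0 ≤ σ) (hσ : 1 - 2 / p < σ) (hc : |c| = 1) (T L : ℝ) :
    ∃ C : ℝ≥0, ∀ w : ℝ → ℝ≥0∞, Measurable w →
      eLpNorm' (longSide l T σ c w) r (volume.restrict (Icc 1 L)) ≤
        C * eLpNorm' w p volume ^ 2 := by
  obtain ⟨C, hC⟩ := exists_lintegral_tailPow_mul_le hp hσ0 hσ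
  obtain ⟨K, hK⟩ := exists_eLpNorm'_truncPow_abs_sub_le (l := l) one_pos (by linarith) T
  lift volume (Icc 1 L) ^ (1 / r) to ℝ≥0 using
    ENNReal.rpow_ne_top_of_nonneg (by positivity) (by simp [Real.volume_Icc]) with V hV
  refine ⟨K * C * V, fun w hw => ?_⟩
  have hle : ∀ s, longSide l T σ c w s ≤ K * (C * eLpNorm' w p volume ^ 2) := by
    intro s
    have hkernel : Measurable fun v => truncPow (-l) T |s - v| :=
      (measurable_truncPow _ _).comp (by fun_prop)
    calc longSide l T σ c w s
        ≤ ∫⁻ v, truncPow (-l) T |s - v| * (C * eLpNorm' w p volume ^ 2) := by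
          refine lintegral_mono fun v => mul_le_mul_right ?_ _
          rw [sq]
          nth_rw 2 [← eLpNorm'_comp_add_mul hc v]
          exact hC w _ hw (hw.comp (by fun_prop))
      _ ≤ _ := by
          rw [lintegral_mul_const _ hkernel]
          gcongr
          simpa [eLpNorm', abs_sub_comm] using hK s
  calc _ ≤ eLpNorm' (fun _ => K * (C * eLpNorm' w p volume ^ 2)) r (volume.restrict (Icc 1 L)) :=
        eLpNorm'_mono_ennreal hr.le hle
    _ = _ := by
        rw [eLpNorm'_const _ hr, enorm_eq_self, Measure.restrict_apply_univ, ← hV]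
        push_cast
        ring

theorem eLpNorm'_lintegral_tailPow_mul_mul_le {p m σ c : ℝ} (hσ : 0 ≤ σ) (hc : |c| = 1)
    (hp : 1 ≤ p) (hpm : p ≤ m) (hm : 1 / m = 2 / p - 1) (hw : Measurable w) :
    eLpNorm' (fun v => ∫⁻ a, tailPow σ a * (w a * w (v + c * a))) m volume ≤
      eLpNorm' w p volume ^ 2 := by
  have hp0 : 0 < p := by linarith
  have young := eLpNorm'_lintegral_mul_le (μ := volume) (ν := volume)
    (k := fun v a => w (v + c * a)) (hw.comp (by fun_prop)) hw hp hpm hp0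
    (by rw [hm]; ring) (K := eLpNorm' w p volume)
    (fun a => by simp only [eLpNorm', lintegral_add_right_eq_self (fun v => ‖w v‖ₑ ^ p), le_rfl])
    (fun v => (eLpNorm'_comp_add_mul hc v).le)
  rw [sq]
  refine (eLpNorm'_mono_ennreal (by linarith) fun v => lintegral_mono fun a => ?_).trans young
  calc tailPow σ a * (w a * w (v + c * a)) ≤ 1 * (w a * w (v + c * a)) := by
        gcongr
        exact tailPow_le_one hσ a
    _ = _ := by ring

/-- The inner integral is bounded in `L^m`, `1 / m = 2 / p - 1`, by dropping `tailPow`. -/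
theorem exists_eLpNorm'_longSide_le_of_lt_two {p r l σ c : ℝ} (hp : 1 < p) (hp2 : p < 2)
    (hr : 0 < r) (hl1 : l < 1) (hl : l < 2 + 1 / r - 2 / p) (hσ0 : 0 ≤ σ) (hc : |c| = 1)
    (T L : ℝ) :
    ∃ C : ℝ≥0, ∀ w : ℝ → ℝ≥0∞, Measurable w →
      eLpNorm' (longSide l T σ c w) r (volume.restrict (Icc 1 L)) ≤
        C * eLpNorm' w p volume ^ 2 := by
  have hp0 : 0 < p := by linarith
  set m : ℝ := 1 / (2 / p - 1)
  have hm_inv : 1 / m = 2 / p - 1 := one_div_one_div _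
  have hm0 : 0 < m := one_div_pos.2 (sub_pos.2 ((one_lt_div hp0).2 hp2))
  have hpm : p ≤ m := by
    rw [← one_div_le_one_div hm0 hp0, hm_inv]
    linarith [(div_lt_one hp0).2 hp, show 2 / p = 2 * (1 / p) by ring]
  have hm1 : 1 / m ≤ 1 := (div_le_one hm0).2 (hp.le.trans hpm)
  set R := max r m
  have hR0 : 0 < R := hr.trans_le (le_max_left _ _)
  have hR_inv : 0 < 1 / R := one_div_pos.2 hR0
  have hlR : l < 1 / R + (1 - 1 / m) := by
    rcases max_choice r m with h | h <;> simp only [R, h] <;> linarith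
  obtain ⟨K, hK⟩ := exists_eLpNorm'_truncPow_abs_sub_le (l := l)
    (m := 1 / (1 / R + (1 - 1 / m))) (one_div_pos.2 (by linarith))
    (by rw [mul_one_div, lt_div_iff₀ (by linarith)]; linarith) T
  lift volume (Icc 1 L) ^ (1 / r - 1 / R) to ℝ≥0 using
    ENNReal.rpow_ne_top_of_nonneg
      (sub_nonneg.2 (one_div_le_one_div_of_le hr (le_max_left _ _)))
      (by simp [Real.volume_Icc]) with V hV
  refine ⟨K * V, fun w hw => ?_⟩
  set H : ℝ → ℝ≥0∞ := fun v => ∫⁻ a, tailPow σ a * (w a * w (v + c * a))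
  have hH : Measurable H := (measurable_tailPow_mul_mul σ c hw).lintegral_prod_right'
  have inner : eLpNorm' H m volume ≤ eLpNorm' w p volume ^ 2 :=
    eLpNorm'_lintegral_tailPow_mul_mul_le hσ0 hc hp.le hpm hm_inv hw
  have outer : eLpNorm' (longSide l T σ c w) R volume ≤ K * eLpNorm' H m volume :=
    eLpNorm'_lintegral_mul_le (k := fun s v => truncPow (-l) T |s - v|)
      ((measurable_truncPow _ _).comp (by fun_prop)) hH (hp.le.trans hpm) (le_max_right r m)
      (one_div_pos.2 (by linarith)) (one_div_one_div _).symm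
      hK fun s => by simpa only [abs_sub_comm] using hK s
  calc eLpNorm' (longSide l T σ c w) r (volume.restrict (Icc 1 L))
      ≤ eLpNorm' (longSide l T σ c w) R (volume.restrict (Icc 1 L)) * V := by
        rw [hV, ← Measure.restrict_apply_univ]
        exact eLpNorm'_le_eLpNorm'_mul_rpow_measure_univ hr (le_max_left _ _)
          (measurable_longSide l T σ c hw).aestronglyMeasurable
    _ ≤ K * eLpNorm' w p volume ^ 2 * V := by
        gcongr
        exact (eLpNorm'_mono_measure _ Measure.restrict_le_self hR0.le).trans
          (outer.trans (by gcongr))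
    _ = _ := by push_cast; ring

theorem exists_eLpNorm'_longSide_le {p r l σ c : ℝ} (hp : 1 < p) (hr : 0 < r)
    (hl1 : l < 1) (hl : l < 2 + 1 / r - 2 / p) (hσ0 : 0 ≤ σ) (hσ : 1 - 2 / p < σ) (hc : |c| = 1)
    (T L : ℝ) :
    ∃ C : ℝ≥0, ∀ w : ℝ → ℝ≥0∞, Measurable w →
      eLpNorm' (longSide l T σ c w) r (volume.restrict (Icc 1 L)) ≤
        C * eLpNorm' w p volume ^ 2 := by
  rcases le_or_gt 2 p with hp2 | hp2
  · exact exists_eLpNorm'_longSide_le_of_two_le hp2 hr hl1 hσ0 hσ hc T L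
  · exact exists_eLpNorm'_longSide_le_of_lt_two hp hp2 hr hl1 hl hσ0 hc T L

end LongSide

section Triangle

/-- A majorant, up to constants, of the kernel of the radial convolution in bipolar coordinates on
triangles with sides `a ≤ b` and `s`; `l` is the order of its singularity at degenerate
triangles. -/
noncomputable def triKernel (l e f s a b : ℝ) : ℝ≥0∞ :=
  if 0 < a ∧ a ≤ b ∧ |b - s| < a then
    ENNReal.ofReal (a ^ (e + l) * b ^ (f - l) * (a - |b - s|) ^ (-l)) else 0

theorem measurable_triKernel (l e f s : ℝ) :
    Measurable (Function.uncurry (triKernel l e f s)) := by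
  unfold triKernel Function.uncurry
  refine Measurable.ite ?_ (by fun_prop) measurable_const
  exact (measurableSet_lt measurable_const measurable_fst).inter
    ((measurableSet_le measurable_fst measurable_snd).inter
      (measurableSet_lt (by fun_prop) measurable_fst))

theorem exists_rpow_le_of_mem_Icc {a : ℝ} (ha : 0 < a) (b q : ℝ) :
    ∃ C : ℝ≥0, ∀ x ∈ Icc a b, x ^ q ≤ C := by
  obtain ⟨C, hC⟩ := isCompact_Icc.exists_bound_of_continuousOn (s := Icc a b)
    fun x hx => (Real.continuousAt_rpow_const x q (.inl (ha.trans_le hx.1).ne')).continuousWithinAt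
  exact ⟨C.toNNReal, fun x hx => (le_abs_self _).trans ((hC x hx).trans (Real.le_coe_toNNReal C))⟩

section KernelBounds

variable {l e f L s a b : ℝ} {C : ℝ≥0}

theorem triKernel_le_weylKernel (hs : s ∈ Icc 1 L) (ha : a < 1)
    (hC : ∀ x ∈ Icc (1 / 2) (L + 1), x ^ (f - l) ≤ C) :
    triKernel l e f s a b ≤ C * weylKernel l e |s - b| a := by
  unfold triKernel
  split_ifs with h
  · obtain ⟨ha0, hab, hbs⟩ := h
    have hbs' := abs_lt.1 hbs
    have : 0 ≤ a - |b - s| := by linarith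
    rw [weylKernel, if_pos ⟨abs_nonneg _, by rwa [abs_sub_comm], ha⟩, abs_sub_comm s b,
      ← ENNReal.ofReal_coe_nnreal, ← ENNReal.ofReal_mul C.coe_nonneg, mul_right_comm,
      mul_comm (C : ℝ)]
    refine ENNReal.ofReal_le_ofReal (mul_le_mul_of_nonneg_left (hC b ?_) (by positivity))
    exact ⟨by linarith [hs.1], by linarith [hs.2]⟩
  · exact zero_le

theorem triKernel_le_truncPow_mul_tailPow (hs : s ∈ Icc 1 L) (ha : 1 ≤ a)
    (hC : ∀ x ∈ Icc (1 / 2) (L + 1), x ^ (f - l) ≤ C) :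
    triKernel l e f s a b ≤
      C * (truncPow (-l) (L + 1) (a - |b - s|) * tailPow (-(e + f)) a) := by
  unfold triKernel
  split_ifs with h
  · obtain ⟨ha0, hab, hbs⟩ := h
    have hside : 0 < a - |b - s| := by linarith
    have hsideL : a - |b - s| < L + 1 := by linarith [neg_abs_le (b - s), le_abs_self (b - s), hs.2]
    have hratio : b / a ∈ Icc (1 / 2) (L + 1) := by
      refine ⟨?_, ?_⟩
      · linarith [(one_le_div ha0).2 hab]
      · rw [div_le_iff₀ ha0]
        nlinarith [hs.1, hs.2, le_abs_self (b - s)]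
    rw [truncPow_of_mem ⟨hside, hsideL⟩, tailPow_of_mem ha, ← ENNReal.ofReal_coe_nnreal,
      ← ENNReal.ofReal_mul (by positivity), ← ENNReal.ofReal_mul C.coe_nonneg]
    apply ENNReal.ofReal_le_ofReal
    calc a ^ (e + l) * b ^ (f - l) * (a - |b - s|) ^ (-l)
        = (b / a) ^ (f - l) * ((a - |b - s|) ^ (-l) * a ^ (e + f)) := by
          rw [Real.div_rpow (ha0.le.trans hab) ha0.le, show e + f = e + l + (f - l) by ring,
            Real.rpow_add ha0 (e + l)]
          field_simp
      _ ≤ C * ((a - |b - s|) ^ (-l) * a ^ (-(-(e + f)))) := by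
          rw [neg_neg]
          gcongr
          exact hC _ hratio
  · exact zero_le

theorem triKernel_le (hs : s ∈ Icc 1 L) (hC : ∀ x ∈ Icc (1 / 2) (L + 1), x ^ (f - l) ≤ C) :
    triKernel l e f s a b ≤ C * (weylKernel l e |s - b| a +
      (truncPow (-l) (L + 1) |s - (b + 1 * a)| + truncPow (-l) (L + 1) |s - (b + -1 * a)|) *
        tailPow (-(e + f)) a) := by
  by_cases hbs : |b - s| < a
  · rcases lt_or_ge a 1 with ha | ha
    · exact (triKernel_le_weylKernel hs ha hC).trans (by gcongr; exact le_self_add)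
    refine (triKernel_le_truncPow_mul_tailPow hs ha hC).trans ?_
    gcongr
    refine le_trans ?_ le_add_self
    gcongr
    rcases le_total b s with h | h
    · rw [show |s - (b + 1 * a)| = a - |b - s| by
        rw [abs_of_nonpos (sub_nonpos.2 h)] at hbs ⊢
        rw [abs_of_nonpos (by linarith)]
        ring]
      exact le_self_add
    · rw [show |s - (b + -1 * a)| = a - |b - s| by
        rw [abs_of_nonneg (sub_nonneg.2 h)] at hbs ⊢
        rw [abs_of_nonneg (by linarith)]
        ring]
      exact le_add_self
  · rw [triKernel, if_neg fun h => hbs h.2.2]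
    exact zero_le

end KernelBounds

variable {w : ℝ → ℝ≥0∞}

theorem measurable_weylKernel_abs_sub_mul (l e s : ℝ) (hw : Measurable w) :
    Measurable (Function.uncurry fun a b : ℝ => weylKernel l e |s - b| a * (w a * w b)) :=
  ((measurable_weylKernel l e).comp
    (by fun_prop : Measurable fun z : ℝ × ℝ => (|s - z.2|, z.1))).mul
      ((hw.comp measurable_fst).mul (hw.comp measurable_snd))

theorem lintegral_lintegral_weylKernel_mul (l e s : ℝ) (hw : Measurable w) :
    ∫⁻ a, ∫⁻ b, weylKernel l e |s - b| a * (w a * w b) = shortSide l e w s := by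
  rw [lintegral_lintegral_swap (measurable_weylKernel_abs_sub_mul l e s hw).aemeasurable]
  refine lintegral_congr fun b => ?_
  have hinner : Measurable fun a => weylKernel l e |s - b| a * w a :=
    ((measurable_weylKernel l e).comp measurable_prodMk_left).mul hw
  simp only [← mul_assoc, lintegral_mul_const _ hinner]

theorem measurable_shortSide (l e : ℝ) (hw : Measurable w) : Measurable (shortSide l e w) := by
  have h : Measurable fun z : (ℝ × ℝ) × ℝ => weylKernel l e |z.1.1 - z.1.2| z.2 * w z.2 :=
    ((measurable_weylKernel l e).comp
      (by fun_prop : Measurable fun z : (ℝ × ℝ) × ℝ => (|z.1.1 - z.1.2|, z.2))).mul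
        (hw.comp measurable_snd)
  have h' : Measurable fun z : ℝ × ℝ => (∫⁻ a, weylKernel l e |z.1 - z.2| a * w a) * w z.2 :=
    h.lintegral_prod_right'.mul (hw.comp measurable_snd)
  exact h'.lintegral_prod_right'

theorem measurable_truncPow_abs_sub_mul (l T σ c s : ℝ) (hw : Measurable w) :
    Measurable (Function.uncurry fun a b : ℝ =>
      truncPow (-l) T |s - (b + c * a)| * tailPow σ a * (w a * w b)) :=
  (((measurable_truncPow _ _).comp (by fun_prop)).mul
    ((measurable_tailPow σ).comp measurable_fst)).mul
      ((hw.comp measurable_fst).mul (hw.comp measurable_snd))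

theorem lintegral_lintegral_truncPow_mul_tailPow_mul (l T σ c s : ℝ) (hw : Measurable w) :
    ∫⁻ a, ∫⁻ b, truncPow (-l) T |s - (b + c * a)| * tailPow σ a * (w a * w b) =
      longSide l T σ (-c) w s := by
  have hkernel : Measurable fun v => truncPow (-l) T |s - v| :=
    (measurable_truncPow _ _).comp (by fun_prop)
  have hprod : Measurable (Function.uncurry fun v a : ℝ =>
      truncPow (-l) T |s - v| * (tailPow σ a * (w a * w (v + -c * a)))) :=
    (hkernel.comp measurable_fst).mul (measurable_tailPow_mul_mul σ (-c) hw)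
  calc ∫⁻ a, ∫⁻ b, truncPow (-l) T |s - (b + c * a)| * tailPow σ a * (w a * w b)
      = ∫⁻ a, ∫⁻ v, truncPow (-l) T |s - v| * (tailPow σ a * (w a * w (v + -c * a))) := by
        refine lintegral_congr fun a => ?_
        rw [← lintegral_sub_right_eq_self _ (c * a)]
        simp [mul_assoc, sub_eq_add_neg]
    _ = longSide l T σ (-c) w s := by
        rw [← lintegral_lintegral_swap hprod.aemeasurable]
        refine lintegral_congr fun v => ?_
        rw [lintegral_const_mul _ (measurable_tailPow_mul_mul σ (-c) hw).of_uncurry_left]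

/-- The integral of `w a w b` against `triKernel` over triangles with third side `s`. -/
noncomputable def triIntegral (l e f : ℝ) (w : ℝ → ℝ≥0∞) (s : ℝ) : ℝ≥0∞ :=
  ∫⁻ a, ∫⁻ b, triKernel l e f s a b * (w a * w b)

theorem lintegral_lintegral_add_left {f : ℝ → ℝ → ℝ≥0∞} (hf : Measurable (Function.uncurry f))
    (g : ℝ → ℝ → ℝ≥0∞) :
    ∫⁻ a, ∫⁻ b, (f a b + g a b) = (∫⁻ a, ∫⁻ b, f a b) + ∫⁻ a, ∫⁻ b, g a b := by
  rw [← lintegral_add_left hf.lintegral_prod_right]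
  refine lintegral_congr fun a => ?_
  rw [lintegral_add_left hf.of_uncurry_left]

theorem triIntegral_le {l e f L s : ℝ} {C : ℝ≥0} (hs : s ∈ Icc 1 L)
    (hC : ∀ x ∈ Icc (1 / 2) (L + 1), x ^ (f - l) ≤ C) (hw : Measurable w) :
    triIntegral l e f w s ≤ C * (shortSide l e w s +
      (longSide l (L + 1) (-(e + f)) (-1) w s + longSide l (L + 1) (-(e + f)) 1 w s)) := by
  calc triIntegral l e f w s
      ≤ ∫⁻ a, ∫⁻ b, C * (weylKernel l e |s - b| a * (w a * w b) +
          (truncPow (-l) (L + 1) |s - (b + 1 * a)| * tailPow (-(e + f)) a * (w a * w b) +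
          truncPow (-l) (L + 1) |s - (b + -1 * a)| * tailPow (-(e + f)) a * (w a * w b))) := by
        refine lintegral_mono fun a => lintegral_mono fun b => ?_
        refine (mul_le_mul_left (triKernel_le hs hC) _).trans_eq ?_
        ring
    _ = _ := by
        simp only [lintegral_const_mul' _ _ ENNReal.coe_ne_top]
        rw [lintegral_lintegral_add_left (measurable_weylKernel_abs_sub_mul l e s hw),
          lintegral_lintegral_add_left (measurable_truncPow_abs_sub_mul l _ _ 1 s hw),
          lintegral_lintegral_weylKernel_mul l e s hw]
        simp only [lintegral_lintegral_truncPow_mul_tailPow_mul _ _ _ _ _ hw, neg_neg]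

theorem exists_eLpNorm'_triIntegral_le {p r l e f : ℝ} (hp : 1 < p) (hpr : p ≤ r)
    (hl1 : l < 1) (hl : l < 2 + 1 / r - 2 / p) (he : 0 < e + (2 + 1 / r - 2 / p))
    (hσ0 : e + f ≤ 0) (hσ : e + f < 2 / p - 1) (L : ℝ) :
    ∃ C : ℝ≥0, ∀ w : ℝ → ℝ≥0∞, Measurable w →
      eLpNorm' (triIntegral l e f w) r (volume.restrict (Icc 1 L)) ≤
        C * eLpNorm' w p volume ^ 2 := by
  have hr1 : 1 ≤ r := by linarith
  have hr0 : 0 < r := by linarith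
  obtain ⟨C₁, hC₁⟩ := exists_eLpNorm'_shortSide_le hp hpr hl1 hl he
  obtain ⟨C₂, hC₂⟩ := exists_eLpNorm'_longSide_le (σ := -(e + f)) (c := -1) hp hr0 hl1 hl
    (by linarith) (by linarith) (by simp) (L + 1) L
  obtain ⟨C₃, hC₃⟩ := exists_eLpNorm'_longSide_le (σ := -(e + f)) (c := 1) hp hr0 hl1 hl
    (by linarith) (by linarith) (by simp) (L + 1) L
  obtain ⟨C, hC⟩ := exists_rpow_le_of_mem_Icc one_half_pos (L + 1) (f - l)
  refine ⟨C * (C₁ + (C₂ + C₃)), fun w hw => ?_⟩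
  set μ : Measure ℝ := volume.restrict (Icc 1 L)
  set S := shortSide l e w
  set M := longSide l (L + 1) (-(e + f)) (-1) w
  set P := longSide l (L + 1) (-(e + f)) 1 w
  have hS : AEStronglyMeasurable S μ := (measurable_shortSide l e hw).aestronglyMeasurable
  have hM : AEStronglyMeasurable M μ := (measurable_longSide _ _ _ _ hw).aestronglyMeasurable
  have hP : AEStronglyMeasurable P μ := (measurable_longSide _ _ _ _ hw).aestronglyMeasurable
  calc eLpNorm' (triIntegral l e f w) r μ
      ≤ C * eLpNorm' (S + (M + P)) r μ := by
        refine eLpNorm'_le_mul_eLpNorm'_of_ae_le_mul (hS.add (hM.add hP)) ?_ hr0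
        exact (ae_restrict_mem measurableSet_Icc).mono fun s hs => triIntegral_le hs hC hw
    _ ≤ C * (eLpNorm' S r μ + (eLpNorm' M r μ + eLpNorm' P r μ)) := by
        gcongr
        refine (eLpNorm'_add_le hS (hM.add hP) hr1).trans ?_
        gcongr
        exact eLpNorm'_add_le hM hP hr1
    _ ≤ C * (C₁ * eLpNorm' w p volume ^ 2 +
          (C₂ * eLpNorm' w p volume ^ 2 + C₃ * eLpNorm' w p volume ^ 2)) := by
        gcongr
        exacts [(eLpNorm'_mono_measure _ Measure.restrict_le_self hr0.le).trans (hC₁ w hw),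
          hC₂ w hw, hC₃ w hw]
    _ = _ := by push_cast; ring

end Triangle

section BipolarCoordinates

theorem lintegral_fun_norm_addHaar {E : Type*} [NormedAddCommGroup E] [NormedSpace ℝ E]
    [MeasurableSpace E] [BorelSpace E] [FiniteDimensional ℝ E] [Nontrivial E] (μ : Measure E)
    [μ.IsAddHaarMeasure] {f : ℝ → ℝ≥0∞} (hf : Measurable f) :
    ∫⁻ x, f ‖x‖ ∂μ = μ.toSphere univ *
      ∫⁻ a in Ioi (0 : ℝ), ENNReal.ofReal (a ^ (Module.finrank ℝ E - 1)) * f a := by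
  have hm : Measurable fun x : Ioi (0 : ℝ) => f x := hf.comp measurable_subtype_coe
  calc ∫⁻ x, f ‖x‖ ∂μ = ∫⁻ x : ({(0 : E)}ᶜ : Set E), f ‖x.1‖ ∂(μ.comap (↑)) := by
        rw [lintegral_subtype_comap (measurableSet_singleton _).compl fun x => f ‖x‖,
          restrict_compl_singleton]
    _ = ∫⁻ x, f x.2 ∂μ.toSphere.prod (.volumeIoiPow (Module.finrank ℝ E - 1)) := by
        simpa using μ.measurePreserving_homeomorphUnitSphereProd.lintegral_comp_emb
          (Homeomorph.measurableEmbedding _) (f ∘ Subtype.val ∘ Prod.snd)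
    _ = μ.toSphere univ * ∫⁻ x : Ioi (0 : ℝ), f x ∂.volumeIoiPow (Module.finrank ℝ E - 1) := by
        rw [lintegral_prod (fun x : Metric.sphere (0 : E) 1 × Ioi (0 : ℝ) => f x.2)
          (hm.comp measurable_snd).aemeasurable]
        simp only [lintegral_const, mul_comm]
    _ = _ := by
        congr 1
        rw [Measure.volumeIoiPow, lintegral_withDensity_eq_lintegral_mul _ (by fun_prop) hm]
        exact lintegral_subtype_comap measurableSet_Ioi
          fun a => ENNReal.ofReal (a ^ (Module.finrank ℝ E - 1)) * f a

/-- The vector of `ℝ^{n+1}` with first coordinate `q.1` and remaining coordinates `q.2`. -/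
def consVec {n : ℕ} (q : ℝ × EuclideanSpace ℝ (Fin n)) : EuclideanSpace ℝ (Fin (n + 1)) :=
  WithLp.toLp 2 (Fin.cons q.1 q.2.ofLp : Fin (n + 1) → ℝ)

theorem measurePreserving_consVec (n : ℕ) :
    MeasurePreserving (consVec (n := n)) (volume.prod volume) volume := by
  have hofLp : MeasurePreserving (Prod.map (id : ℝ → ℝ)
      (WithLp.ofLp : EuclideanSpace ℝ (Fin n) → Fin n → ℝ)) (volume.prod volume)
      (volume.prod volume) := (MeasurePreserving.id volume).prod (PiLp.volume_preserving_ofLp _)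
  have hcons := (volume_preserving_piFinSuccAbove (fun _ : Fin (n + 1) => ℝ) 0).symm
  have hcomp : consVec (n := n) = (WithLp.toLp 2 ∘
      (MeasurableEquiv.piFinSuccAbove (fun _ : Fin (n + 1) => ℝ) 0).symm) ∘
      Prod.map id WithLp.ofLp := by
    funext q
    exact congrArg (WithLp.toLp 2) (Fin.insertNth_zero' _ _).symm
  rw [hcomp]
  exact ((PiLp.volume_preserving_toLp (Fin (n + 1))).comp hcons).comp hofLp

theorem norm_consVec {n : ℕ} (q : ℝ × EuclideanSpace ℝ (Fin n)) :
    ‖consVec q‖ = √(q.1 ^ 2 + ‖q.2‖ ^ 2) := by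
  rw [EuclideanSpace.norm_eq, EuclideanSpace.real_norm_sq_eq, Fin.sum_univ_succ]
  simp [consVec]

theorem single_sub_consVec {n : ℕ} (s : ℝ) (q : ℝ × EuclideanSpace ℝ (Fin n)) :
    EuclideanSpace.single 0 s - consVec q = consVec (s - q.1, -q.2) := by
  ext i
  refine Fin.cases ?_ (fun j => ?_) i <;> simp [consVec]

/-- The convolution square of the radial function `F ‖·‖` on `ℝ^{n+1}`, evaluated at a point of
norm `|s|`. -/
noncomputable def radConv (n : ℕ) (F : ℝ → ℝ≥0∞) (s : ℝ) : ℝ≥0∞ :=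
  ∫⁻ y : EuclideanSpace ℝ (Fin (n + 1)), F ‖y‖ * F ‖EuclideanSpace.single 0 s - y‖

theorem lintegral_norm_mul_norm_sub {n : ℕ} (F : ℝ → ℝ≥0∞)
    (x : EuclideanSpace ℝ (Fin (n + 1))) :
    ∫⁻ y, F ‖y‖ * F ‖x - y‖ = radConv n F ‖x‖ := by
  set v : EuclideanSpace ℝ (Fin (n + 1)) := EuclideanSpace.single 0 ‖x‖ with hv
  have hxv : ‖x‖ = ‖v‖ := by simp [hv]
  set e := (Submodule.span ℝ {x - v})ᗮ.reflection
  have hex : e x = v := Submodule.reflection_sub hxv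
  refine Eq.trans (lintegral_congr fun y => ?_)
    ((LinearIsometryEquiv.measurePreserving e).lintegral_comp_emb
      e.toHomeomorph.measurableEmbedding (fun y => F ‖y‖ * F ‖v - y‖))
  rw [LinearIsometryEquiv.norm_map, ← hex, ← map_sub, LinearIsometryEquiv.norm_map]

theorem radConv_eq_lintegral_lintegral {n : ℕ} (hn : 1 ≤ n) {F : ℝ → ℝ≥0∞} (hF : Measurable F)
    (s : ℝ) :
    radConv n F s = (volume : Measure (EuclideanSpace ℝ (Fin n))).toSphere univ *
      ∫⁻ z : ℝ, ∫⁻ ρ in Ioi (0 : ℝ), ENNReal.ofReal (ρ ^ (n - 1)) *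
        (F √(z ^ 2 + ρ ^ 2) * F √((s - z) ^ 2 + ρ ^ 2)) := by
  have : Nonempty (Fin n) := ⟨⟨0, hn⟩⟩
  have hm : Measurable fun y : EuclideanSpace ℝ (Fin (n + 1)) =>
      F ‖y‖ * F ‖EuclideanSpace.single 0 s - y‖ :=
    (hF.comp measurable_norm).mul (hF.comp (by fun_prop))
  have hm2 : Measurable fun q : ℝ × ℝ => F √(q.1 ^ 2 + q.2 ^ 2) * F √((s - q.1) ^ 2 + q.2 ^ 2) :=
    (hF.comp (by fun_prop)).mul (hF.comp (by fun_prop))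
  have hm3 : Measurable fun z : ℝ => ∫⁻ ρ in Ioi (0 : ℝ), ENNReal.ofReal (ρ ^ (n - 1)) *
        (F √(z ^ 2 + ρ ^ 2) * F √((s - z) ^ 2 + ρ ^ 2)) :=
    (Measurable.mul (f := fun q : ℝ × ℝ => ENNReal.ofReal (q.2 ^ (n - 1)))
      (by fun_prop) hm2).lintegral_prod_right'
  rw [radConv, ← (measurePreserving_consVec n).lintegral_comp hm,
    lintegral_prod (fun q => F ‖consVec q‖ * F ‖EuclideanSpace.single 0 s - consVec q‖)
      (hm.comp (measurePreserving_consVec n).measurable).aemeasurable,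
    ← lintegral_const_mul _ hm3]
  refine lintegral_congr fun z => ?_
  simp only [single_sub_consVec, norm_consVec, norm_neg]
  simpa only [finrank_euclideanSpace_fin, Function.comp_def] using
    lintegral_fun_norm_addHaar (volume : Measure (EuclideanSpace ℝ (Fin n)))
      (hm2.comp measurable_prodMk_left)

theorem setLIntegral_abs_deriv_mul_comp_le {f f' : ℝ → ℝ} {s t : Set ℝ} (hs : MeasurableSet s)
    (hf' : ∀ x ∈ s, HasDerivWithinAt f (f' x) s x) (hf : InjOn f s) (hst : MapsTo f s t)
    (g : ℝ → ℝ≥0∞) :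
    ∫⁻ x in s, ENNReal.ofReal |f' x| * g (f x) ≤ ∫⁻ y in t, g y := by
  rw [← lintegral_image_eq_lintegral_abs_deriv_mul hs hf' hf]
  exact lintegral_mono_set hst.image_subset

theorem setLIntegral_pow_mul_comp_sqrt_le {n : ℕ} (hn : 1 ≤ n) (Ψ : ℝ → ℝ≥0∞) (z : ℝ) :
    ∫⁻ ρ in Ioi (0 : ℝ), ENNReal.ofReal (ρ ^ (n - 1)) * Ψ √(z ^ 2 + ρ ^ 2) ≤
      ∫⁻ a in Ioi |z|, ENNReal.ofReal (a * (a ^ 2 - z ^ 2) ^ (((n : ℝ) - 2) / 2)) * Ψ a := by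
  have hpos {ρ : ℝ} (hρ : 0 < ρ) : 0 < z ^ 2 + ρ ^ 2 := by positivity
  have hderiv : ∀ ρ ∈ Ioi (0 : ℝ), HasDerivWithinAt (fun ρ => √(z ^ 2 + ρ ^ 2))
      (ρ / √(z ^ 2 + ρ ^ 2)) (Ioi 0) ρ := fun ρ hρ => by
    refine (((hasDerivAt_pow 2 ρ).const_add (z ^ 2)).sqrt (hpos hρ).ne').hasDerivWithinAt
      |>.congr_deriv ?_
    have := Real.sqrt_pos.2 (hpos hρ)
    field_simp
    norm_num
  have hinj : InjOn (fun ρ => √(z ^ 2 + ρ ^ 2)) (Ioi (0 : ℝ)) := fun x hx y hy hxy =>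
    (sq_eq_sq₀ (le_of_lt hx) (le_of_lt hy)).1 <|
      add_left_cancel ((Real.sqrt_inj (hpos hx).le (hpos hy).le).1 hxy)
  have hmaps : MapsTo (fun ρ => √(z ^ 2 + ρ ^ 2)) (Ioi (0 : ℝ)) (Ioi |z|) := fun ρ hρ => by
    refine Real.lt_sqrt_of_sq_lt ?_
    rw [sq_abs]
    exact lt_add_of_pos_right _ (pow_pos hρ 2)
  refine le_trans (le_of_eq (setLIntegral_congr_fun measurableSet_Ioi fun ρ hρ => ?_))
    (setLIntegral_abs_deriv_mul_comp_le measurableSet_Ioi hderiv hinj hmaps _)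
  have hρ : 0 < ρ := hρ
  have hsqrt := Real.sqrt_pos.2 (hpos hρ)
  have hpow : ρ * (ρ ^ 2) ^ (((n : ℝ) - 2) / 2) = ρ ^ (n - 1) := by
    rw [← Real.rpow_natCast ρ 2, ← Real.rpow_mul hρ.le, ← Real.rpow_natCast, Nat.cast_sub hn,
      show ((n : ℝ) - (1 : ℕ)) = 1 + (2 : ℕ) * ((n - 2) / 2) by push_cast; ring,
      Real.rpow_add hρ, Real.rpow_one]
  simp only [Real.sq_sqrt (hpos hρ).le, add_sub_cancel_left]
  rw [← mul_assoc, ← ENNReal.ofReal_mul (abs_nonneg _), abs_of_pos (by positivity), ← mul_assoc,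
    div_mul_cancel₀ _ hsqrt.ne', hpow]

theorem setLIntegral_comp_sqrt_le (H : ℝ → ℝ → ℝ≥0∞) {a s : ℝ} (ha : 0 < a) (hs : 0 < s) :
    ∫⁻ z in Ioo (-a) a, H z √(s ^ 2 - 2 * s * z + a ^ 2) ≤
      ∫⁻ b in Ioo |s - a| (s + a),
        ENNReal.ofReal (b / s) * H ((s ^ 2 + a ^ 2 - b ^ 2) / (2 * s)) b := by
  have hlt : ∀ z ∈ Ioo (-a) a, |s - a| ^ 2 < s ^ 2 - 2 * s * z + a ^ 2 := fun z hz => by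
    rw [sq_abs]; nlinarith [hz.2]
  have hpos : ∀ z ∈ Ioo (-a) a, 0 < s ^ 2 - 2 * s * z + a ^ 2 := fun z hz =>
    (sq_nonneg _).trans_lt (hlt z hz)
  have hderiv : ∀ z ∈ Ioo (-a) a, HasDerivWithinAt (fun z => √(s ^ 2 - 2 * s * z + a ^ 2))
      (-s / √(s ^ 2 - 2 * s * z + a ^ 2)) (Ioo (-a) a) z := fun z hz => by
    refine (((((hasDerivAt_id z).const_mul (2 * s)).const_sub (s ^ 2)).add_const
      (a ^ 2)).sqrt (hpos z hz).ne').hasDerivWithinAt |>.congr_deriv ?_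
    have := Real.sqrt_pos.2 (hpos z hz)
    simp only [id]
    field_simp
  have hinj : InjOn (fun z => √(s ^ 2 - 2 * s * z + a ^ 2)) (Ioo (-a) a) := fun x hx y hy hxy =>
    mul_left_cancel₀ hs.ne' (by linarith [(Real.sqrt_inj (hpos x hx).le (hpos y hy).le).1 hxy])
  have hmaps : MapsTo (fun z => √(s ^ 2 - 2 * s * z + a ^ 2)) (Ioo (-a) a)
      (Ioo |s - a| (s + a)) := fun z hz =>
    ⟨Real.lt_sqrt_of_sq_lt (hlt z hz), (Real.sqrt_lt' (by positivity)).2 (by nlinarith [hz.1])⟩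
  refine le_trans (le_of_eq (setLIntegral_congr_fun measurableSet_Ioo fun z hz => ?_))
    (setLIntegral_abs_deriv_mul_comp_le measurableSet_Ioo hderiv hinj hmaps _)
  have hsqrt := Real.sqrt_pos.2 (hpos z hz)
  have hz' : (s ^ 2 + a ^ 2 - (s ^ 2 - 2 * s * z + a ^ 2)) / (2 * s) = z := by field_simp; ring
  simp only [Real.sq_sqrt (hpos z hz).le, hz']
  rw [← mul_assoc, ← ENNReal.ofReal_mul (abs_nonneg _), neg_div, abs_neg,
    abs_of_pos (by positivity), div_mul_div_cancel₀ hsqrt.ne', div_self hs.ne', ENNReal.ofReal_one,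
    one_mul]

/-- The square of the height over the side `s` of the triangle with sides `a`, `b`, `s`. -/
noncomputable def sqHeight (s a b : ℝ) : ℝ := a ^ 2 - ((s ^ 2 + a ^ 2 - b ^ 2) / (2 * s)) ^ 2

/-- The density of the convolution square of a radial function on `ℝ^{n+1}`, at a point of norm `s`,
with respect to the distances `a` and `b` of the integration variable to the two foci, up to the
area of the unit sphere of `ℝ^n`. -/
noncomputable def bipolarKernel (n : ℕ) (s a b : ℝ) : ℝ≥0∞ :=
  if 0 < a ∧ |s - a| < b ∧ b < s + a then
    ENNReal.ofReal (a * (b / s) * sqHeight s a b ^ (((n : ℝ) - 2) / 2)) else 0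

theorem radConv_le_lintegral_setLIntegral {n : ℕ} (hn : 1 ≤ n) {F : ℝ → ℝ≥0∞}
    (hF : Measurable F) (s : ℝ) :
    radConv n F s ≤ (volume : Measure (EuclideanSpace ℝ (Fin n))).toSphere univ *
      ∫⁻ a, ∫⁻ z in Ioo (-a) a, ENNReal.ofReal (a * (a ^ 2 - z ^ 2) ^ (((n : ℝ) - 2) / 2)) *
        (F a * F √(s ^ 2 - 2 * s * z + a ^ 2)) := by
  rw [radConv_eq_lintegral_lintegral hn hF]
  set Φ : ℝ → ℝ → ℝ≥0∞ := fun z a =>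
    ENNReal.ofReal (a * (a ^ 2 - z ^ 2) ^ (((n : ℝ) - 2) / 2)) *
      (F a * F √(s ^ 2 - 2 * s * z + a ^ 2))
  set cone : Set (ℝ × ℝ) := {q | |q.1| < q.2}
  have hcone : MeasurableSet cone := measurableSet_lt (by fun_prop) measurable_snd
  have hΦm : Measurable (Function.uncurry Φ) := Measurable.mul (by fun_prop)
    ((hF.comp measurable_snd).mul (hF.comp (by fun_prop)))
  refine mul_le_mul' le_rfl ?_
  calc ∫⁻ z : ℝ, ∫⁻ ρ in Ioi (0 : ℝ), ENNReal.ofReal (ρ ^ (n - 1)) *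
        (F √(z ^ 2 + ρ ^ 2) * F √((s - z) ^ 2 + ρ ^ 2))
      = ∫⁻ z : ℝ, ∫⁻ ρ in Ioi (0 : ℝ), ENNReal.ofReal (ρ ^ (n - 1)) *
        (F √(z ^ 2 + ρ ^ 2) * F √(s ^ 2 - 2 * s * z + √(z ^ 2 + ρ ^ 2) ^ 2)) := by
        refine lintegral_congr fun z => lintegral_congr fun ρ => ?_
        rw [Real.sq_sqrt (by positivity)]
        ring_nf
    _ ≤ ∫⁻ z, ∫⁻ a in Ioi |z|, Φ z a :=
        lintegral_mono fun z => setLIntegral_pow_mul_comp_sqrt_le hn _ z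
    _ = ∫⁻ z, ∫⁻ a, cone.indicator (Function.uncurry Φ) (z, a) :=
        lintegral_congr fun z => (lintegral_indicator measurableSet_Ioi _).symm
    _ = ∫⁻ a, ∫⁻ z, cone.indicator (Function.uncurry Φ) (z, a) :=
        lintegral_lintegral_swap (hΦm.indicator hcone).aemeasurable
    _ = ∫⁻ a, ∫⁻ z in Ioo (-a) a, Φ z a := by
        refine lintegral_congr fun a => ?_
        rw [← lintegral_indicator measurableSet_Ioo]
        simp only [indicator, cone, mem_ofPred_eq, mem_Ioo, abs_lt, Function.uncurry_apply_pair]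

theorem radConv_le_lintegral_bipolarKernel {n : ℕ} (hn : 1 ≤ n) {F : ℝ → ℝ≥0∞}
    (hF : Measurable F) {s : ℝ} (hs : 0 < s) :
    radConv n F s ≤ (volume : Measure (EuclideanSpace ℝ (Fin n))).toSphere univ *
      ∫⁻ a, ∫⁻ b, bipolarKernel n s a b * (F a * F b) := by
  refine (radConv_le_lintegral_setLIntegral hn hF s).trans ?_
  refine mul_le_mul' le_rfl (lintegral_mono fun a => ?_)
  rcases le_or_gt a 0 with ha | ha
  · rw [Ioo_eq_empty (by linarith), setLIntegral_empty]
    exact zero_le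
  · refine (setLIntegral_comp_sqrt_le (fun z b =>
      ENNReal.ofReal (a * (a ^ 2 - z ^ 2) ^ (((n : ℝ) - 2) / 2)) * (F a * F b)) ha hs).trans_eq ?_
    rw [← lintegral_indicator measurableSet_Ioo]
    refine lintegral_congr fun b => ?_
    by_cases hb : b ∈ Ioo |s - a| (s + a)
    · have hb0 : 0 < b := (abs_nonneg _).trans_lt hb.1
      rw [indicator_of_mem hb, bipolarKernel, if_pos ⟨ha, hb⟩, ← mul_assoc,
        ← ENNReal.ofReal_mul (by positivity), mul_left_comm (b / s), ← mul_assoc a,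
        sqHeight]
    · rw [indicator_of_notMem hb, bipolarKernel, if_neg fun h => hb h.2, zero_mul]

end BipolarCoordinates

section BipolarBounds

theorem sqHeight_comm {s : ℝ} (hs : s ≠ 0) (a b : ℝ) : sqHeight s a b = sqHeight s b a := by
  unfold sqHeight
  field_simp
  ring

theorem sqHeight_le_sq (s a b : ℝ) : sqHeight s a b ≤ a ^ 2 := sub_le_self _ (sq_nonneg _)

theorem sqHeight_eq_heron {s : ℝ} (hs : s ≠ 0) (a b : ℝ) :
    sqHeight s a b = (a + b + s) * (b + s - a) * (a ^ 2 - (b - s) ^ 2) / (4 * s ^ 2) := by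
  unfold sqHeight
  field_simp
  ring

theorem le_sqHeight {s a b : ℝ} (hs : 0 < s) (ha : 0 < a) (hab : a ≤ b) (hbs : |b - s| < a) :
    a * b * (a - |b - s|) / (4 * s) ≤ sqHeight s a b := by
  rw [sqHeight_eq_heron hs.ne', div_le_div_iff₀ (by positivity) (by positivity)]
  have : 0 < a - |b - s| := sub_pos.2 hbs
  have : 0 < b := ha.trans_le hab
  have hdiff : a * (a - |b - s|) ≤ a ^ 2 - (b - s) ^ 2 := by
    rw [← sq_abs (b - s)]; nlinarith [abs_nonneg (b - s)]
  have hsum : b * s ≤ (a + b + s) * (b + s - a) := by nlinarith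
  have hprod : b * s * (a * (a - |b - s|)) ≤
      (a + b + s) * (b + s - a) * (a ^ 2 - (b - s) ^ 2) :=
    mul_le_mul hsum hdiff (by positivity) (mul_nonneg (by linarith) (by linarith))
  calc a * b * (a - |b - s|) * (4 * s ^ 2) = b * s * (a * (a - |b - s|)) * (4 * s) := by ring
    _ ≤ _ := by gcongr

theorem bipolarKernel_comm (n : ℕ) {s : ℝ} (hs : 0 < s) {a b : ℝ} (ha : 0 < a) (hb : 0 < b) :
    bipolarKernel n s a b = bipolarKernel n s b a := by
  have hcond : (0 < a ∧ |s - a| < b ∧ b < s + a) ↔ (0 < b ∧ |s - b| < a ∧ a < s + b) := by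
    simp only [abs_lt]
    grind
  simp only [bipolarKernel, sqHeight_comm hs.ne' a b, mul_div_left_comm a b s, hcond]

/-- The order of the singularity, at degenerate triangles, of the bipolar kernel in dimension
`n + 1`. -/
noncomputable def singExp (n : ℕ) : ℝ := if n = 1 then 1 / 2 else 0

theorem singExp_lt_one (n : ℕ) : singExp n < 1 := by
  unfold singExp; split_ifs <;> norm_num

theorem mul_sqHeight_rpow_neg_half_le {s a b : ℝ} (hs : 1 ≤ s) (ha : 0 < a) (hab : a ≤ b)
    (hbs : |b - s| < a) :
    a * (b / s) * sqHeight s a b ^ (-(1 / 2) : ℝ) ≤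
      2 * (a ^ (1 / 2 : ℝ) * b ^ (1 / 2 : ℝ) * (a - |b - s|) ^ (-(1 / 2) : ℝ)) := by
  have hs0 : 0 < s := by linarith
  have hb : 0 < b := ha.trans_le hab
  have hside : 0 < a - |b - s| := sub_pos.2 hbs
  set δ := a - |b - s|
  have hfour : √4 = 2 := by rw [show (4 : ℝ) = 2 ^ 2 by norm_num, Real.sqrt_sq zero_le_two]
  have hsqrt : √(a * b * δ / (4 * s)) = √a * √b * √δ / (2 * √s) := by
    rw [Real.sqrt_div (by positivity), Real.sqrt_mul (by positivity), Real.sqrt_mul ha.le,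
      Real.sqrt_mul zero_le_four, hfour]
  calc a * (b / s) * sqHeight s a b ^ (-(1 / 2) : ℝ)
      ≤ a * (b / s) * (a * b * δ / (4 * s)) ^ (-(1 / 2) : ℝ) := by
        gcongr ?_ * ?_
        exact Real.rpow_le_rpow_of_nonpos (by positivity) (le_sqHeight hs0 ha hab hbs) (by norm_num)
    _ = √a ^ 2 * (√b ^ 2 / √s ^ 2) / (√a * √b * √δ / (2 * √s)) := by
        rw [Real.rpow_neg (by positivity), ← Real.sqrt_eq_rpow, hsqrt, Real.sq_sqrt ha.le,
          Real.sq_sqrt hb.le, Real.sq_sqrt hs0.le, div_eq_mul_inv (a * (b / s))]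
    _ = 2 * (√a * √b * (√δ)⁻¹) / √s := by
        have := Real.sqrt_pos.2 ha
        have := Real.sqrt_pos.2 hb
        have := Real.sqrt_pos.2 hs0
        have := Real.sqrt_pos.2 hside
        field_simp
    _ ≤ 2 * (√a * √b * (√δ)⁻¹) := div_le_self (by positivity) (Real.one_le_sqrt.2 hs)
    _ = _ := by rw [Real.rpow_neg hside.le]; simp only [Real.sqrt_eq_rpow]

theorem mul_sqHeight_rpow_le {s a b k : ℝ} (hs : 1 ≤ s) (ha : 0 < a) (hab : a ≤ b)
    (hbs : |b - s| < a) (hk : 0 ≤ k) :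
    a * (b / s) * sqHeight s a b ^ (k / 2) ≤ a ^ (k + 1) * b := by
  have hb : 0 < b := ha.trans_le hab
  have hs0 : 0 < s := by linarith
  have hheight : 0 ≤ sqHeight s a b :=
    le_trans (by have := sub_pos.2 hbs; positivity) (le_sqHeight hs0 ha hab hbs)
  calc a * (b / s) * sqHeight s a b ^ (k / 2) ≤ a * b * (a ^ 2) ^ (k / 2) := by
        gcongr
        · exact div_le_self hb.le hs
        · exact sqHeight_le_sq s a b
    _ = a ^ (k + 1) * b := by
        rw [← Real.rpow_natCast, ← Real.rpow_mul ha.le, Real.rpow_add_one ha.ne']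
        push_cast
        ring_nf

theorem bipolarKernel_le_of_le {n : ℕ} (hn : 1 ≤ n) {s : ℝ} (hs : 1 ≤ s) {a b : ℝ}
    (hab : a ≤ b) :
    bipolarKernel n s a b ≤ 2 * triKernel (singExp n) (n - 1) 1 s a b := by
  unfold bipolarKernel
  split_ifs with h
  · obtain ⟨ha, hsab, hbs⟩ := h
    have hbs : |b - s| < a := abs_lt.2 ⟨by linarith [(abs_lt.1 hsab).2], by linarith⟩
    have hb : 0 < b := ha.trans_le hab
    rw [triKernel, if_pos ⟨ha, hab, hbs⟩, ← ENNReal.ofReal_ofNat 2,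
      ← ENNReal.ofReal_mul zero_le_two]
    refine ENNReal.ofReal_le_ofReal ?_
    obtain rfl | hn2 := hn.eq_or_lt
    · convert mul_sqHeight_rpow_neg_half_le hs ha hab hbs using 5 <;> norm_num [singExp]
    · have hn2 : (2 : ℝ) ≤ n := mod_cast hn2
      refine (mul_sqHeight_rpow_le hs ha hab hbs (sub_nonneg.2 hn2)).trans ?_
      rw [singExp, if_neg (by rintro rfl; norm_num at hn2),
        show (n : ℝ) - 2 + 1 = n - 1 + 0 by ring, sub_zero, neg_zero,
        Real.rpow_one, Real.rpow_zero, mul_one]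
      exact le_mul_of_one_le_left (by positivity) one_le_two
  · exact zero_le

theorem bipolarKernel_le {n : ℕ} (hn : 1 ≤ n) {s : ℝ} (hs : 1 ≤ s) (a b : ℝ) :
    bipolarKernel n s a b ≤ 2 * (triKernel (singExp n) (n - 1) 1 s a b +
      triKernel (singExp n) (n - 1) 1 s b a) := by
  rw [mul_add]
  rcases le_total a b with h | h
  · exact (bipolarKernel_le_of_le hn hs h).trans le_self_add
  · by_cases hab : 0 < a ∧ |s - a| < b ∧ b < s + a
    · rw [bipolarKernel_comm n (by linarith) hab.1 ((abs_nonneg _).trans_lt hab.2.1)]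
      exact (bipolarKernel_le_of_le hn hs h).trans le_add_self
    · rw [bipolarKernel, if_neg hab]
      exact zero_le

theorem triKernel_mul_mul (l e f m s a b : ℝ) (F : ℝ → ℝ≥0∞) :
    triKernel l e f s a b * (F a * F b) = triKernel l (e - m) (f - m) s a b *
      (ENNReal.ofReal (a ^ m) * F a * (ENNReal.ofReal (b ^ m) * F b)) := by
  unfold triKernel
  split_ifs with h
  · obtain ⟨ha, hab, hbs⟩ := h
    have hb : 0 < b := ha.trans_le hab
    have : 0 < a - |b - s| := sub_pos.2 hbs
    have hpow : a ^ (e + l) * b ^ (f - l) * (a - |b - s|) ^ (-l) =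
        a ^ (e - m + l) * b ^ (f - m - l) * (a - |b - s|) ^ (-l) * (a ^ m * b ^ m) := by
      rw [show e + l = (e - m + l) + m by ring, show f - l = (f - m - l) + m by ring,
        Real.rpow_add ha, Real.rpow_add hb]
      ring
    rw [hpow, ENNReal.ofReal_mul (by positivity), ENNReal.ofReal_mul (show 0 ≤ a ^ m by positivity)]
    ring
  · simp only [zero_mul]

/-- The profile `a ↦ a^m F(a)` on `(0, ∞)`, extended by zero. -/
noncomputable def weightedProfile (m : ℝ) (F : ℝ → ℝ≥0∞) : ℝ → ℝ≥0∞ :=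
  (Ioi 0).indicator fun a => ENNReal.ofReal (a ^ m) * F a

theorem measurable_weightedProfile (m : ℝ) {F : ℝ → ℝ≥0∞} (hF : Measurable F) :
    Measurable (weightedProfile m F) :=
  (Measurable.mul (by fun_prop) hF).indicator measurableSet_Ioi

theorem triIntegral_eq_triIntegral_weightedProfile (l e f m : ℝ) (F : ℝ → ℝ≥0∞) (s : ℝ) :
    triIntegral l e f F s = triIntegral l (e - m) (f - m) (weightedProfile m F) s := by
  refine lintegral_congr fun a => lintegral_congr fun b => ?_
  rw [triKernel_mul_mul _ _ _ m]
  by_cases hab : 0 < a ∧ a ≤ b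
  · rw [weightedProfile, indicator_of_mem (show a ∈ Ioi 0 from hab.1),
      indicator_of_mem (show b ∈ Ioi 0 from hab.1.trans_le hab.2)]
  · rw [triKernel, if_neg fun h => hab ⟨h.1, h.2.1⟩, zero_mul, zero_mul]

theorem radConv_le_triIntegral {n : ℕ} (hn : 1 ≤ n) {F : ℝ → ℝ≥0∞} (hF : Measurable F) {s : ℝ}
    (hs : 1 ≤ s) :
    radConv n F s ≤ (volume : Measure (EuclideanSpace ℝ (Fin n))).toSphere univ *
      (4 * triIntegral (singExp n) (n - 1) 1 F s) := by
  set k := triKernel (singExp n) (n - 1) 1 s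
  have hk : Measurable (Function.uncurry fun a b => k a b * (F a * F b)) :=
    (measurable_triKernel _ _ _ s).mul ((hF.comp measurable_fst).mul (hF.comp measurable_snd))
  refine (radConv_le_lintegral_bipolarKernel hn hF (by linarith)).trans (mul_le_mul' le_rfl ?_)
  calc ∫⁻ a, ∫⁻ b, bipolarKernel n s a b * (F a * F b)
      ≤ ∫⁻ a, ∫⁻ b, 2 * (k a b * (F a * F b) + k b a * (F b * F a)) := by
        refine lintegral_mono fun a => lintegral_mono fun b => ?_
        refine (mul_le_mul_left (bipolarKernel_le hn hs a b) _).trans_eq ?_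
        ring
    _ = 2 * ((∫⁻ a, ∫⁻ b, k a b * (F a * F b)) + ∫⁻ a, ∫⁻ b, k b a * (F b * F a)) := by
        simp only [lintegral_const_mul' _ _ (ENNReal.ofNat_ne_top (n := 2)),
          lintegral_lintegral_add_left hk]
    _ = 2 * ((∫⁻ a, ∫⁻ b, k a b * (F a * F b)) + ∫⁻ a, ∫⁻ b, k a b * (F a * F b)) := by
        rw [lintegral_lintegral_swap (f := fun a b => k b a * (F b * F a)) (hk.comp
          measurable_swap).aemeasurable]
    _ = 4 * triIntegral (singExp n) (n - 1) 1 F s := by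
        rw [triIntegral]
        ring

theorem exists_eLpNorm'_radConv_le {n : ℕ} (hn : 1 ≤ n) {p r m : ℝ} (hp : 1 < p) (hpr : p ≤ r)
    (hl : singExp n < 2 + 1 / r - 2 / p) (he : 0 < n - 1 - m + (2 + 1 / r - 2 / p))
    (hσ0 : n ≤ 2 * m) (hσ : 1 - 2 / p < 2 * m - n) (L : ℝ) :
    ∃ C : ℝ≥0, ∀ F : ℝ → ℝ≥0∞, Measurable F →
      eLpNorm' (radConv n F) r (volume.restrict (Icc 1 L)) ≤
        C * eLpNorm' (weightedProfile m F) p volume ^ 2 := by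
  have hr : 0 < r := by linarith
  obtain ⟨C, hC⟩ := exists_eLpNorm'_triIntegral_le (f := 1 - m) hp hpr (singExp_lt_one n) hl he
    (by linarith) (by linarith) L
  lift (volume : Measure (EuclideanSpace ℝ (Fin n))).toSphere univ to ℝ≥0 using measure_ne_top _ _
    with A hA
  refine ⟨A * 4 * C, fun F hF => ?_⟩
  calc eLpNorm' (radConv n F) r (volume.restrict (Icc 1 L))
      ≤ (A * 4 : ℝ≥0) * eLpNorm' (triIntegral (singExp n) (n - 1) 1 F) r
          (volume.restrict (Icc 1 L)) := by
        refine eLpNorm'_le_nnreal_smul_eLpNorm'_of_ae_le_mul' ?_ hr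
        filter_upwards [ae_restrict_mem measurableSet_Icc] with s hs
        simpa only [enorm_eq_self, ← hA, ENNReal.coe_mul, ENNReal.coe_ofNat, mul_assoc] using
          radConv_le_triIntegral hn hF hs.1
    _ ≤ (A * 4 : ℝ≥0) * (C * eLpNorm' (weightedProfile m F) p volume ^ 2) := by
        rw [funext (triIntegral_eq_triIntegral_weightedProfile _ _ _ m F)]
        exact mul_le_mul' le_rfl (hC _ (measurable_weightedProfile m hF))
    _ = _ := by rw [ENNReal.coe_mul (A * 4), mul_assoc]

end BipolarBounds

section Scaling

theorem lintegral_comp_const_smul {E : Type*} [NormedAddCommGroup E] [NormedSpace ℝ E]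
    [MeasurableSpace E] [BorelSpace E] [FiniteDimensional ℝ E] (μ : Measure E)
    [μ.IsAddHaarMeasure] {g : E → ℝ≥0∞} (hg : Measurable g) {R : ℝ} (hR : 0 < R) :
    ∫⁻ x, g (R • x) ∂μ = ENNReal.ofReal (R ^ (-(Module.finrank ℝ E : ℝ))) * ∫⁻ x, g x ∂μ := by
  rw [← lintegral_map hg (measurable_const_smul R), Measure.map_addHaar_smul μ hR.ne',
    lintegral_smul_measure, abs_of_pos (by positivity), smul_eq_mul, Real.rpow_neg hR.le,
    Real.rpow_natCast]

theorem single_zero_mul {n : ℕ} (R s : ℝ) :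
    (EuclideanSpace.single 0 (R * s) : EuclideanSpace ℝ (Fin (n + 1))) =
      R • EuclideanSpace.single 0 s := by
  ext i
  simp

theorem measurable_radConv (n : ℕ) {F : ℝ → ℝ≥0∞} (hF : Measurable F) :
    Measurable (radConv n F) := by
  have hsingle : Continuous fun s : ℝ =>
      (EuclideanSpace.single 0 s : EuclideanSpace ℝ (Fin (n + 1))) :=
    (continuous_id.smul (continuous_const (y := EuclideanSpace.single 0 (1 : ℝ)))).congr
      fun s => by simp [← single_zero_mul]
  have hsub : Continuous fun q : ℝ × EuclideanSpace ℝ (Fin (n + 1)) =>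
      ‖EuclideanSpace.single 0 q.1 - q.2‖ :=
    ((hsingle.comp continuous_fst).sub continuous_snd).norm
  exact Measurable.lintegral_prod_right' (f := fun q : ℝ × EuclideanSpace ℝ (Fin (n + 1)) =>
    F ‖q.2‖ * F ‖EuclideanSpace.single 0 q.1 - q.2‖)
    ((hF.comp (by fun_prop)).mul (hF.comp hsub.measurable))

theorem radConv_comp_mul (n : ℕ) {F : ℝ → ℝ≥0∞} (hF : Measurable F) {R : ℝ} (hR : 0 < R) (s : ℝ) :
    radConv n F (R * s) =
      ENNReal.ofReal (R ^ ((n : ℝ) + 1)) * radConv n (fun a => F (R * a)) s := by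
  have hm : Measurable fun y : EuclideanSpace ℝ (Fin (n + 1)) =>
      F ‖y‖ * F ‖EuclideanSpace.single 0 (R * s) - y‖ :=
    (hF.comp measurable_norm).mul (hF.comp (by fun_prop))
  have hdil : radConv n (fun a => F (R * a)) s =
      ENNReal.ofReal (R ^ (-((n : ℝ) + 1))) * radConv n F (R * s) := by
    have h := lintegral_comp_const_smul volume hm hR
    rw [finrank_euclideanSpace_fin, Nat.cast_add_one] at h
    rw [radConv, radConv, ← h]
    refine lintegral_congr fun y => ?_
    rw [single_zero_mul, ← smul_sub, norm_smul, norm_smul, Real.norm_of_nonneg hR.le]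
  rw [hdil, ← mul_assoc, ← ENNReal.ofReal_mul (by positivity), ← Real.rpow_add hR,
    add_neg_cancel, Real.rpow_zero, ENNReal.ofReal_one, one_mul]

theorem eLpNorm'_comp_mul {w : ℝ → ℝ≥0∞} (hw : Measurable w) {R p : ℝ} (hR : 0 < R)
    (hp : 0 < p) :
    eLpNorm' (fun a => w (R * a)) p volume =
      ENNReal.ofReal (R ^ (-(1 / p))) * eLpNorm' w p volume := by
  have h := lintegral_comp_const_smul volume (hw.enorm.pow_const p) hR
  simp only [Module.finrank_self, Nat.cast_one, smul_eq_mul] at h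
  rw [eLpNorm', h, ENNReal.mul_rpow_of_nonneg _ _ (by positivity),
    ENNReal.ofReal_rpow_of_pos (by positivity), ← Real.rpow_mul hR.le, neg_one_mul, eLpNorm']

theorem weightedProfile_comp_mul (m : ℝ) (F : ℝ → ℝ≥0∞) {R : ℝ} (hR : 0 < R) (a : ℝ) :
    weightedProfile m (fun a => F (R * a)) a =
      ENNReal.ofReal (R ^ (-m)) * weightedProfile m F (R * a) := by
  rcases le_or_gt a 0 with ha | ha
  · rw [weightedProfile, weightedProfile, indicator_of_notMem (notMem_Ioi.2 ha),
      indicator_of_notMem (notMem_Ioi.2 (mul_nonpos_of_nonneg_of_nonpos hR.le ha)), mul_zero]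
  · rw [weightedProfile, weightedProfile, indicator_of_mem (mem_Ioi.2 ha),
      indicator_of_mem (mem_Ioi.2 (mul_pos hR ha)), ← mul_assoc,
      ← ENNReal.ofReal_mul (by positivity), Real.mul_rpow hR.le ha.le, ← mul_assoc,
      ← Real.rpow_add hR, neg_add_cancel, Real.rpow_zero, one_mul]

theorem eLpNorm'_weightedProfile_comp_mul_le {m p R : ℝ} {F : ℝ → ℝ≥0∞} (hF : Measurable F)
    (hR : 0 < R) (hp : 0 < p) :
    eLpNorm' (weightedProfile m fun a => F (R * a)) p volume ≤
      ENNReal.ofReal (R ^ (-(m + 1 / p))) * eLpNorm' (weightedProfile m F) p volume := by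
  calc eLpNorm' (weightedProfile m fun a => F (R * a)) p volume
      ≤ ENNReal.ofReal (R ^ (-m)) *
          eLpNorm' (fun a => weightedProfile m F (R * a)) p volume := by
        refine eLpNorm'_le_nnreal_smul_eLpNorm'_of_ae_le_mul' (.of_forall fun a => ?_) hp
        exact (weightedProfile_comp_mul m F hR a).le
    _ = _ := by
        rw [eLpNorm'_comp_mul (measurable_weightedProfile m hF) hR hp, ← mul_assoc,
          ← ENNReal.ofReal_mul (by positivity), ← Real.rpow_add hR, neg_add]

theorem exists_eLpNorm'_radConv_comp_mul_le {n : ℕ} (hn : 1 ≤ n) {p r m : ℝ} (hp : 1 < p)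
    (hpr : p ≤ r) (hl : singExp n < 2 + 1 / r - 2 / p)
    (he : 0 < n - 1 - m + (2 + 1 / r - 2 / p)) (hσ0 : n ≤ 2 * m) (hσ : 1 - 2 / p < 2 * m - n)
    (L : ℝ) :
    ∃ C : ℝ≥0, ∀ F : ℝ → ℝ≥0∞, Measurable F → ∀ R : ℝ, 0 < R →
      eLpNorm' (fun s => radConv n F (R * s)) r (volume.restrict (Icc 1 L)) ≤
        C * ENNReal.ofReal (R ^ (-(2 * m + 2 / p - (n + 1)))) *
          eLpNorm' (weightedProfile m F) p volume ^ 2 := by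
  obtain ⟨C, hC⟩ := exists_eLpNorm'_radConv_le hn hp hpr hl he hσ0 hσ L
  refine ⟨C, fun F hF R hR => ?_⟩
  calc eLpNorm' (fun s => radConv n F (R * s)) r (volume.restrict (Icc 1 L))
      ≤ ENNReal.ofReal (R ^ ((n : ℝ) + 1)) *
          eLpNorm' (radConv n fun a => F (R * a)) r (volume.restrict (Icc 1 L)) := by
        refine eLpNorm'_le_nnreal_smul_eLpNorm'_of_ae_le_mul' (.of_forall fun s => ?_)
          (by linarith)
        exact (radConv_comp_mul n hF hR s).le
    _ ≤ ENNReal.ofReal (R ^ ((n : ℝ) + 1)) * (C * (ENNReal.ofReal (R ^ (-(m + 1 / p))) *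
          eLpNorm' (weightedProfile m F) p volume) ^ 2) := by
        refine mul_le_mul' le_rfl ((hC _ (hF.comp (measurable_const_mul R))).trans ?_)
        gcongr
        exact eLpNorm'_weightedProfile_comp_mul_le hF hR (by linarith)
    _ = _ := by
        rw [mul_pow, ← ENNReal.ofReal_pow (by positivity), ← Real.rpow_mul_natCast hR.le,
          show -(2 * m + 2 / p - (n + 1)) = (n + 1 : ℝ) + -(m + 1 / p) * (2 : ℕ) by
            push_cast; ring,
          Real.rpow_add hR (n + 1 : ℝ), ENNReal.ofReal_mul (by positivity)]
        ac_rfl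

end Scaling

section Smoothing

theorem mul_sub_one_le_rpow_sub_one {γ L t : ℝ} (hγ : 0 ≤ γ) (ht : t ∈ Icc 1 L) :
    γ / L * (t - 1) ≤ t ^ γ - 1 := by
  have ht0 : 0 < t := zero_lt_one.trans_le ht.1
  calc γ / L * (t - 1) = γ * (L⁻¹ * (t - 1)) := by ring
    _ ≤ γ * (t⁻¹ * (t - 1)) := by
        have := sub_nonneg.2 ht.1
        have := inv_anti₀ ht0 ht.2
        gcongr
    _ = γ * (1 - t⁻¹) := by field_simp
    _ ≤ γ * Real.log t := by gcongr; exact Real.one_sub_inv_le_log_of_pos ht0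
    _ ≤ t ^ γ - 1 := by
        rw [← Real.log_rpow ht0]
        exact Real.log_le_sub_one_of_pos (by positivity)

theorem lintegral_Ici_exp_neg_mul_sub {k : ℝ} (hk : 0 < k) (a : ℝ) :
    ∫⁻ t in Ici a, ENNReal.ofReal (Real.exp (-k * (t - a))) = ENNReal.ofReal k⁻¹ := by
  have hexp : ∀ t, Real.exp (-k * (t - a)) = Real.exp (k * a) * Real.exp (-k * t) := fun t => by
    rw [← Real.exp_add]
    ring_nf
  simp only [hexp]
  rw [← restrict_Ioi_eq_restrict_Ici, ← ofReal_integral_eq_lintegral_ofReal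
    ((integrableOn_exp_mul_Ioi (neg_neg_of_pos hk) a).const_mul _)
    (.of_forall fun t => by positivity), integral_const_mul, integral_exp_mul_Ioi
    (neg_neg_of_pos hk), neg_div_neg_eq, ← mul_div_assoc, ← Real.exp_add]
  simp

theorem lintegral_Icc_exp_neg_mul_sub_le {k L : ℝ} (hk : 0 < k) :
    ∫⁻ t in Icc 1 L, ENNReal.ofReal (Real.exp (-k * (t - 1))) ≤ ENNReal.ofReal (min L k⁻¹) := by
  rw [ENNReal.ofReal_min]
  refine le_min ?_ ?_
  · calc ∫⁻ t in Icc 1 L, ENNReal.ofReal (Real.exp (-k * (t - 1))) ≤ ∫⁻ _ in Icc 1 L, 1 := by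
          refine setLIntegral_mono' measurableSet_Icc fun t ht => ?_
          rw [ENNReal.ofReal_le_one, Real.exp_le_one_iff, neg_mul, neg_nonpos]
          exact mul_nonneg hk.le (sub_nonneg.2 ht.1)
      _ ≤ _ := by
          rw [setLIntegral_one, Real.volume_Icc]
          gcongr
          linarith
  · exact (lintegral_mono_set Icc_subset_Ici_self).trans_eq (lintegral_Ici_exp_neg_mul_sub hk 1)

theorem exists_eLpNorm'_exp_rpow_le {γ L q : ℝ} (hγ : 0 < γ) (hL : 0 < L) (hq : 0 < q) :
    ∃ C : ℝ≥0, ∀ ρ : ℝ, 0 < ρ →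
      eLpNorm' (fun t => ENNReal.ofReal (Real.exp (ρ ^ γ * (1 - t ^ γ)))) q
          (volume.restrict (Icc 1 L)) ≤
        C * ENNReal.ofReal (min 1 (ρ ^ (-γ)) ^ (1 / q)) := by
  set c := γ / L * q
  refine ⟨Real.toNNReal (max L c⁻¹ ^ (1 / q)), fun ρ hρ => ?_⟩
  have hmin : 0 ≤ min 1 (ρ ^ (-γ)) := by positivity
  have : 0 < c := by positivity
  have hexp : ∀ t ∈ Icc 1 L, ‖ENNReal.ofReal (Real.exp (ρ ^ γ * (1 - t ^ γ)))‖ₑ ^ q ≤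
      ENNReal.ofReal (Real.exp (-(c * ρ ^ γ) * (t - 1))) := fun t ht => by
    rw [enorm_eq_self, ENNReal.ofReal_rpow_of_pos (Real.exp_pos _), ← Real.exp_mul]
    refine ENNReal.ofReal_le_ofReal (Real.exp_le_exp.2 ?_)
    calc ρ ^ γ * (1 - t ^ γ) * q = -(ρ ^ γ * q * (t ^ γ - 1)) := by ring
      _ ≤ -(ρ ^ γ * q * (γ / L * (t - 1))) := by
          gcongr
          exact mul_sub_one_le_rpow_sub_one hγ.le ht
      _ = -(c * ρ ^ γ) * (t - 1) := by ring
  calc eLpNorm' (fun t => ENNReal.ofReal (Real.exp (ρ ^ γ * (1 - t ^ γ)))) q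
          (volume.restrict (Icc 1 L))
      ≤ ENNReal.ofReal (min L (c * ρ ^ γ)⁻¹) ^ (1 / q) := by
        rw [eLpNorm']
        gcongr
        exact (setLIntegral_mono' measurableSet_Icc hexp).trans
          (lintegral_Icc_exp_neg_mul_sub_le (by positivity))
    _ ≤ ENNReal.ofReal (max L c⁻¹ * min 1 (ρ ^ (-γ))) ^ (1 / q) := by
        rw [mul_min_of_nonneg _ _ (by positivity), mul_one, mul_inv, ← Real.rpow_neg hρ.le]
        gcongr
        exacts [le_max_left .., le_max_right ..]
    _ = ENNReal.ofReal (max L c⁻¹ ^ (1 / q)) * ENNReal.ofReal (min 1 (ρ ^ (-γ)) ^ (1 / q)) := by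
        rw [ENNReal.ofReal_rpow_of_nonneg (by positivity) (by positivity),
          Real.mul_rpow (by positivity) hmin, ENNReal.ofReal_mul (by positivity)]

theorem exists_lintegral_exp_mul_radConv_le {n : ℕ} (hn : 1 ≤ n) {p r m γ L : ℝ} (hp : 1 < p)
    (hpr : p ≤ r) (hl : singExp n < 2 + 1 / r - 2 / p)
    (he : 0 < n - 1 - m + (2 + 1 / r - 2 / p)) (hσ0 : n ≤ 2 * m) (hσ : 1 - 2 / p < 2 * m - n)
    (hγ : 0 < γ) (hL : 0 < L) :
    ∃ C : ℝ≥0, ∀ F : ℝ → ℝ≥0∞, Measurable F → ∀ ρ : ℝ, 0 < ρ →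
      ∫⁻ t in Icc 1 L, ENNReal.ofReal (Real.exp (ρ ^ γ * (1 - t ^ γ))) * radConv n F (ρ * t) ≤
        C * ENNReal.ofReal (min 1 (ρ ^ (-γ)) ^ (1 - 1 / r) *
          ρ ^ (-(2 * m + 2 / p - (n + 1)))) * eLpNorm' (weightedProfile m F) p volume ^ 2 := by
  have hr : r.HolderConjugate r.conjExponent := .conjExponent (hp.trans_le hpr)
  obtain ⟨C₁, hC₁⟩ := exists_eLpNorm'_radConv_comp_mul_le hn hp hpr hl he hσ0 hσ L
  obtain ⟨C₂, hC₂⟩ := exists_eLpNorm'_exp_rpow_le hγ hL hr.symm.pos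
  refine ⟨C₂ * C₁, fun F hF ρ hρ => ?_⟩
  have holder := ENNReal.lintegral_mul_le_Lp_mul_Lq (volume.restrict (Icc 1 L)) hr.symm
    (f := fun t => ENNReal.ofReal (Real.exp (ρ ^ γ * (1 - t ^ γ))))
    (g := fun t => radConv n F (ρ * t)) (by fun_prop)
    ((measurable_radConv n hF).comp (measurable_const_mul ρ)).aemeasurable
  refine (holder.trans (mul_le_mul' (hC₂ ρ hρ) (hC₁ F hF ρ hρ))).trans_eq ?_
  rw [one_div r.conjExponent, ← hr.one_sub_inv, one_div r, ENNReal.ofReal_mul (by positivity),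
    ENNReal.coe_mul]
  ring

end Smoothing

section RadialProfiles

theorem ae_iff_ae_polar {E : Type*} [NormedAddCommGroup E] [NormedSpace ℝ E]
    [MeasurableSpace E] [BorelSpace E] [FiniteDimensional ℝ E] [Nontrivial E] (μ : Measure E)
    [μ.IsAddHaarMeasure] (P : E → Prop) :
    (∀ᵐ x ∂μ, P x) ↔
      ∀ᵐ q ∂μ.toSphere.prod (.volumeIoiPow (Module.finrank ℝ E - 1)), P (q.2.1 • q.1.1) := by
  set e := homeomorphUnitSphereProd E
  have hpolar : (∀ᵐ x : ({(0 : E)}ᶜ : Set E) ∂μ.comap (↑), P x) ↔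
      ∀ᵐ q ∂μ.toSphere.prod (.volumeIoiPow (Module.finrank ℝ E - 1)), P (e.symm q) := by
    rw [← μ.measurePreserving_homeomorphUnitSphereProd.map_eq, e.measurableEmbedding.ae_map_iff]
    simp only [e, Homeomorph.symm_apply_apply]
  have hsubtype : (∀ᵐ x ∂μ, P x) ↔ ∀ᵐ x : ({(0 : E)}ᶜ : Set E) ∂μ.comap (↑), P x := by
    conv_lhs => rw [← restrict_compl_singleton (μ := μ) (0 : E),
      ← map_comap_subtype_coe (measurableSet_singleton (0 : E)).compl]
    exact (MeasurableEmbedding.subtype_coe (measurableSet_singleton (0 : E)).compl).ae_map_iff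
  simpa only [e, homeomorphUnitSphereProd_symm_apply_coe] using hsubtype.trans hpolar

theorem exists_measurable_profile {E : Type*} [NormedAddCommGroup E] [NormedSpace ℝ E]
    [MeasurableSpace E] [BorelSpace E] [FiniteDimensional ℝ E] [Nontrivial E] (μ : Measure E)
    [μ.IsAddHaarMeasure] {h : E → ℝ≥0∞} (hm : AEMeasurable h μ)
    (hrad : ∀ x y, ‖x‖ = ‖y‖ → h x = h y) :
    ∃ φ : ℝ → ℝ≥0∞, Measurable φ ∧ ∀ᵐ x ∂μ, h x = φ ‖x‖ := by
  have hray := Measure.ae_ae_of_ae_prod ((ae_iff_ae_polar μ _).1 hm.ae_eq_mk)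
  have : (ae μ.toSphere).NeBot := ae_neBot.2 (Measure.toSphere_ne_zero μ)
  obtain ⟨ω, hω⟩ := hray.exists
  refine ⟨fun a => hm.mk h (a • (ω : E)), hm.measurable_mk.comp (by fun_prop), ?_⟩
  rw [ae_iff_ae_polar μ]
  filter_upwards [Measure.quasiMeasurePreserving_snd.ae hω] with q hq
  have hnorm : ‖q.2.1 • q.1.1‖ = q.2.1 := by
    simp [norm_smul, abs_of_pos (show 0 < q.2.1 from q.2.2)]
  rw [hnorm, ← hq]
  exact hrad _ _ (by simp [norm_smul])

theorem memLp_ofReal_iff {α E : Type*} [MeasurableSpace α] [NormedAddCommGroup E] {μ : Measure α}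
    {p : ℝ} (hp : 0 < p) {f : α → E} (hf : AEStronglyMeasurable f μ) :
    MemLp f (ENNReal.ofReal p) μ ↔ ∫⁻ x, ‖f x‖ₑ ^ p ∂μ < ⊤ := by
  rw [MemLp, and_iff_right hf, eLpNorm_lt_top_iff_lintegral_rpow_enorm_lt_top (by simpa using hp)
    ENNReal.ofReal_ne_top, ENNReal.toReal_ofReal hp.le]

theorem lintegral_norm_rpow_mul_rpow {n : ℕ} {p : ℝ} (hp : 0 < p) (ν : ℝ) {F : ℝ → ℝ≥0∞}
    (hF : Measurable F) :
    ∫⁻ x : EuclideanSpace ℝ (Fin (n + 1)), (ENNReal.ofReal (‖x‖ ^ ν) * F ‖x‖) ^ p =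
      (volume : Measure (EuclideanSpace ℝ (Fin (n + 1)))).toSphere univ *
        ∫⁻ a, weightedProfile (ν + n / p) F a ^ p := by
  have hprofile : (fun a => weightedProfile (ν + n / p) F a ^ p) = (Ioi 0).indicator
      fun a => ENNReal.ofReal (a ^ n) * (ENNReal.ofReal (a ^ ν) * F a) ^ p := by
    funext a
    by_cases ha : a ∈ Ioi 0
    · have ha0 : 0 < a := ha
      rw [weightedProfile, indicator_of_mem ha, indicator_of_mem ha,
        ENNReal.mul_rpow_of_nonneg _ _ hp.le, ENNReal.mul_rpow_of_nonneg _ _ hp.le,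
        ENNReal.ofReal_rpow_of_pos (by positivity), ENNReal.ofReal_rpow_of_pos (by positivity),
        ← mul_assoc, ← ENNReal.ofReal_mul (by positivity), Real.rpow_add ha0, mul_comm (a ^ ν),
        Real.mul_rpow (by positivity) (by positivity), ← Real.rpow_mul ha0.le _ p,
        div_mul_cancel₀ _ hp.ne', Real.rpow_natCast]
    · rw [weightedProfile, indicator_of_notMem ha, indicator_of_notMem ha,
        ENNReal.zero_rpow_of_pos hp]
  rw [lintegral_fun_norm_addHaar volume
    (f := fun a => (ENNReal.ofReal (a ^ ν) * F a) ^ p)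
    ((Measurable.mul (by fun_prop) hF).pow_const p), finrank_euclideanSpace_fin,
    Nat.add_sub_cancel, hprofile, lintegral_indicator measurableSet_Ioi]

theorem exists_profile_of_memWeightedLp {n : ℕ} {ν p : ℝ} (hp : 0 < p)
    {g : EuclideanSpace ℝ (Fin (n + 1)) → EuclideanSpace ℂ (Fin (n + 1))}
    (hg : MemWeightedLp (uWeight ν) p g) (hrad : IsRadialField g) :
    ∃ F : ℝ → ℝ≥0∞, Measurable F ∧
      (∀ᵐ x, ‖g x‖ₑ = ENNReal.ofReal (Real.exp (-‖x‖)) * F ‖x‖) ∧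
      eLpNorm' (weightedProfile (ν + n / p) F) p volume ≠ ⊤ := by
  obtain ⟨φ, hφ, hgφ⟩ := exists_measurable_profile volume (h := fun x => ‖g x‖ₑ) hg.1.enorm
    (fun x y hxy => by simp only [hrad x y hxy])
  have hF : Measurable fun a => ENNReal.ofReal (Real.exp a) * φ a :=
    Measurable.mul (by fun_prop) hφ
  refine ⟨fun a => ENNReal.ofReal (Real.exp a) * φ a, hF, ?_, ?_⟩
  · filter_upwards [hgφ] with x hx
    rw [hx, ← mul_assoc, ← ENNReal.ofReal_mul (Real.exp_pos _).le, ← Real.exp_add, neg_add_cancel,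
      Real.exp_zero, ENNReal.ofReal_one, one_mul]
  · have hfin : ∫⁻ x : EuclideanSpace ℝ (Fin (n + 1)),
        (ENNReal.ofReal (‖x‖ ^ ν) * (ENNReal.ofReal (Real.exp ‖x‖) * φ ‖x‖)) ^ p < ⊤ := by
      refine (lintegral_congr_ae ?_).trans_lt ((memLp_ofReal_iff hp hg.2.1).1 hg.2)
      filter_upwards [hgφ] with x hx
      rw [enorm_smul, hx, uWeight, Real.enorm_of_nonneg (by positivity), ← mul_assoc,
        ← ENNReal.ofReal_mul (by positivity), mul_comm (Real.exp _)]
    rw [lintegral_norm_rpow_mul_rpow hp ν hF] at hfin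
    have hsphere : (volume : Measure (EuclideanSpace ℝ (Fin (n + 1)))).toSphere univ ≠ 0 := by
      rw [ne_eq, Measure.measure_univ_eq_zero]
      exact Measure.toSphere_ne_zero _
    exact ENNReal.rpow_ne_top_of_nonneg (by positivity)
      (ENNReal.lt_top_of_mul_ne_top_right hfin.ne hsphere).ne

theorem lintegral_Ioi_rpow_mul_min_rpow_lt_top {a b γ : ℝ} (ha : -1 < a) (hb : 0 ≤ b)
    (hab : a + 1 < γ * b) :
    ∫⁻ ρ in Ioi (0 : ℝ), ENNReal.ofReal (ρ ^ a * min 1 (ρ ^ (-γ)) ^ b) < ⊤ := by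
  have hsmall : IntegrableOn (fun ρ : ℝ => ρ ^ a) (Ioc 0 1) :=
    (intervalIntegral.intervalIntegrable_rpow' (a := 0) (b := 1) ha).1
  have hlarge : IntegrableOn (fun ρ : ℝ => ρ ^ (a - γ * b)) (Ioi 1) :=
    integrableOn_Ioi_rpow_of_lt (by linarith) one_pos
  rw [← Ioc_union_Ioi_eq_Ioi zero_le_one, lintegral_union measurableSet_Ioi
    (Ioc_disjoint_Ioi le_rfl), ENNReal.add_lt_top]
  constructor
  · refine (setLIntegral_mono' measurableSet_Ioc fun ρ hρ => ?_).trans_lt hsmall.lintegral_lt_top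
    have hρ0 : 0 < ρ := hρ.1
    refine ENNReal.ofReal_le_ofReal (mul_le_of_le_one_right (by positivity) ?_)
    exact Real.rpow_le_one (by positivity) (min_le_left _ _) hb
  · refine (setLIntegral_mono' measurableSet_Ioi fun ρ hρ => ?_).trans_lt hlarge.lintegral_lt_top
    have hρ0 : 0 < ρ := one_pos.trans hρ
    refine ENNReal.ofReal_le_ofReal ?_
    calc ρ ^ a * min 1 (ρ ^ (-γ)) ^ b ≤ ρ ^ a * (ρ ^ (-γ)) ^ b := by
          gcongr
          exact min_le_right _ _
      _ = ρ ^ (a - γ * b) := by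
          rw [← Real.rpow_mul hρ0.le, ← Real.rpow_add hρ0, neg_mul, sub_eq_add_neg]

theorem memLp_min_rpow_mul_norm_rpow {n : ℕ} {p x y γ : ℝ} (hp : 0 < p) (hy : 0 ≤ y)
    (h0 : 0 < n + 1 + p * x) (h1 : n + 1 + p * x < γ * p * y) :
    MemLp (fun η : EuclideanSpace ℝ (Fin (n + 1)) => min 1 (‖η‖ ^ (-γ)) ^ y * ‖η‖ ^ x)
      (ENNReal.ofReal p) := by
  have hm : Measurable fun ρ : ℝ => min 1 (ρ ^ (-γ)) ^ y * ρ ^ x := by fun_prop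
  refine (memLp_ofReal_iff hp (hm.comp measurable_norm).aestronglyMeasurable).2 ?_
  have hpolar := lintegral_fun_norm_addHaar
    (volume : Measure (EuclideanSpace ℝ (Fin (n + 1)))) (hm.enorm.pow_const p)
  refine hpolar.trans_lt ?_
  rw [finrank_euclideanSpace_fin, Nat.add_sub_cancel]
  refine ENNReal.mul_lt_top (measure_lt_top _ _) ((setLIntegral_congr_fun measurableSet_Ioi
    fun ρ hρ => ?_).trans_lt (lintegral_Ioi_rpow_mul_min_rpow_lt_top (a := n + p * x)
      (b := y * p) (γ := γ) (by linarith) (by positivity) (by linarith)))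
  have hρ0 : 0 < ρ := hρ
  rw [Real.enorm_of_nonneg (by positivity), ENNReal.ofReal_rpow_of_nonneg (by positivity) hp.le,
    ← ENNReal.ofReal_mul (by positivity), Real.mul_rpow (by positivity) (by positivity),
    ← Real.rpow_mul (by positivity), ← Real.rpow_mul hρ0.le, Real.rpow_add hρ0,
    Real.rpow_natCast, mul_comm x p]
  congr 1
  ring

end RadialProfiles

section PointwiseBounds

theorem norm_dotC_le {d : ℕ} (η : EuclideanSpace ℝ (Fin d)) (v : EuclideanSpace ℂ (Fin d)) :
    ‖dotC η v‖ ≤ ‖η‖ * ‖v‖ := by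
  rw [EuclideanSpace.norm_eq, EuclideanSpace.norm_eq]
  calc ‖dotC η v‖ ≤ ∑ i, ‖η i‖ * ‖v i‖ := by
        refine (norm_sum_le _ _).trans_eq (Finset.sum_congr rfl fun i _ => ?_)
        rw [norm_mul, Complex.norm_real]
    _ ≤ _ := Real.sum_mul_le_sqrt_mul_sqrt _ _ _

theorem norm_leray_le {d : ℕ} (η : EuclideanSpace ℝ (Fin d)) (v : EuclideanSpace ℂ (Fin d)) :
    ‖leray η v‖ ≤ 2 * ‖v‖ := by
  set ηC : EuclideanSpace ℂ (Fin d) := WithLp.toLp 2 fun i => (η i : ℂ)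
  have hnorm : ‖ηC‖ = ‖η‖ := by simp [ηC, EuclideanSpace.norm_eq]
  have hleray : leray η v = v - (dotC η v / (‖η‖ : ℂ) ^ 2) • ηC := by
    ext i
    simp [leray, ηC]
  have hparallel : ‖(dotC η v / (‖η‖ : ℂ) ^ 2) • ηC‖ ≤ ‖v‖ := by
    rw [norm_smul, norm_div, norm_pow, Complex.norm_real, norm_norm, hnorm]
    rcases (norm_nonneg η).eq_or_lt with hη | hη
    · simp [← hη]
    · calc ‖dotC η v‖ / ‖η‖ ^ 2 * ‖η‖ ≤ ‖η‖ * ‖v‖ / ‖η‖ ^ 2 * ‖η‖ := by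
            gcongr
            exact norm_dotC_le η v
        _ = ‖v‖ := by field_simp
  rw [hleray]
  linarith [norm_sub_le v ((dotC η v / (‖η‖ : ℂ) ^ 2) • ηC)]

theorem norm_bilinearIntegrand_le {d : ℕ}
    (ϑ : EuclideanSpace ℝ (Fin d) → EuclideanSpace ℂ (Fin d)) (η : EuclideanSpace ℝ (Fin d))
    (t : ℝ) (x : EuclideanSpace ℝ (Fin d)) :
    ‖bilinearIntegrand ϑ η t x‖ ≤ 2 * ‖η‖ * (‖ϑ x‖ * ‖ϑ (t • η - x)‖) := by
  rw [bilinearIntegrand, norm_smul]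
  calc _ ≤ (‖η‖ * ‖ϑ (t • η - x)‖) * (2 * ‖ϑ x‖) := by
        gcongr
        exacts [norm_dotC_le _ _, norm_leray_le _ _]
    _ = _ := by ring

theorem exp_neg_norm_mul_exp_neg_norm_sub_le {E : Type*} [NormedAddCommGroup E] [NormedSpace ℝ E]
    (η x : E) {t : ℝ} (ht : 1 ≤ t) :
    Real.exp (-‖x‖) * Real.exp (-‖t • η - x‖) ≤ Real.exp (-‖η‖) := by
  have htri : ‖t • η‖ ≤ ‖x‖ + ‖t • η - x‖ := by
    simpa using norm_add_le x (t • η - x)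
  rw [norm_smul, Real.norm_of_nonneg (by linarith)] at htri
  rw [← Real.exp_add, Real.exp_le_exp]
  nlinarith [norm_nonneg η]

theorem lintegral_enorm_bilinearIntegrand_le {n : ℕ}
    {ϑ : EuclideanSpace ℝ (Fin (n + 1)) → EuclideanSpace ℂ (Fin (n + 1))} {F : ℝ → ℝ≥0∞}
    (hϑF : ∀ᵐ x, ‖ϑ x‖ₑ ≤ ENNReal.ofReal (Real.exp (-‖x‖)) * F ‖x‖)
    (η : EuclideanSpace ℝ (Fin (n + 1))) {t : ℝ} (ht : 1 ≤ t) :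
    ∫⁻ x, ‖bilinearIntegrand ϑ η t x‖ₑ ≤
      ENNReal.ofReal (2 * (‖η‖ * Real.exp (-‖η‖))) * radConv n F (‖η‖ * t) := by
  have hϑF' : ∀ᵐ x, ‖ϑ (t • η - x)‖ₑ ≤
      ENNReal.ofReal (Real.exp (-‖t • η - x‖)) * F ‖t • η - x‖ :=
    (quasiMeasurePreserving_sub_left volume (t • η)).ae hϑF
  have hnorm : ‖η‖ * t = ‖t • η‖ := by
    rw [norm_smul, Real.norm_of_nonneg (by linarith), mul_comm]
  rw [hnorm, ← lintegral_norm_mul_norm_sub, ← lintegral_const_mul' _ _ ENNReal.ofReal_ne_top]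
  refine lintegral_mono_ae ?_
  filter_upwards [hϑF, hϑF'] with x hx hx'
  calc ‖bilinearIntegrand ϑ η t x‖ₑ
      ≤ ENNReal.ofReal (2 * ‖η‖ * (‖ϑ x‖ * ‖ϑ (t • η - x)‖)) := by
        rw [← ofReal_norm]
        exact ENNReal.ofReal_le_ofReal (norm_bilinearIntegrand_le ϑ η t x)
    _ = ENNReal.ofReal (2 * ‖η‖) * (‖ϑ x‖ₑ * ‖ϑ (t • η - x)‖ₑ) := by
        rw [ENNReal.ofReal_mul (by positivity), ENNReal.ofReal_mul (norm_nonneg (ϑ x)),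
          ofReal_norm, ofReal_norm]
    _ ≤ ENNReal.ofReal (2 * ‖η‖) * ((ENNReal.ofReal (Real.exp (-‖x‖)) * F ‖x‖) *
          (ENNReal.ofReal (Real.exp (-‖t • η - x‖)) * F ‖t • η - x‖)) := by gcongr
    _ = ENNReal.ofReal (2 * ‖η‖) * ENNReal.ofReal (Real.exp (-‖x‖) * Real.exp (-‖t • η - x‖)) *
          (F ‖x‖ * F ‖t • η - x‖) := by
        rw [ENNReal.ofReal_mul (Real.exp_pos _).le]
        ring
    _ ≤ ENNReal.ofReal (2 * ‖η‖) * ENNReal.ofReal (Real.exp (-‖η‖)) *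
          (F ‖x‖ * F ‖t • η - x‖) := by
        gcongr
        exact exp_neg_norm_mul_exp_neg_norm_sub_le η x ht
    _ = _ := by rw [← ENNReal.ofReal_mul (by positivity), mul_assoc]

theorem exists_enorm_timeFactor_le (d : ℕ) (γ L : ℝ) :
    ∃ B : ℝ≥0, ∀ (η : EuclideanSpace ℝ (Fin d)), ∀ t ∈ Icc 1 L,
      ‖timeFactor γ η t‖ₑ ≤ B * ENNReal.ofReal (Real.exp (‖η‖ ^ γ * (1 - t ^ γ))) := by
  obtain ⟨B, hB⟩ := exists_rpow_le_of_mem_Icc one_pos L (-cExp d γ)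
  refine ⟨B, fun η t ht => ?_⟩
  have ht0 : 0 < t := one_pos.trans_le ht.1
  rw [timeFactor, Real.enorm_of_nonneg (by positivity), ← ENNReal.ofReal_coe_nnreal,
    ← ENNReal.ofReal_mul B.coe_nonneg, div_eq_mul_inv, ← Real.rpow_neg ht0.le, mul_comm]
  gcongr
  exact hB t ht

/-- The total mass `∫_1^{1/β} ∫ |e^{|η|^γ (1 - t^γ)} t^{-c} (η · ϑ(tη - x)) P_η ϑ(x)| dx dt` of
the nonlinear term of `renorm γ β ϑ η`. -/
noncomputable def nonlinearMass {d : ℕ} (γ β : ℝ)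
    (ϑ : EuclideanSpace ℝ (Fin d) → EuclideanSpace ℂ (Fin d)) (η : EuclideanSpace ℝ (Fin d)) :
    ℝ≥0∞ :=
  ∫⁻ t in Ioc 1 (1 / β), ∫⁻ x, ‖timeFactor γ η t • bilinearIntegrand ϑ η t x‖ₑ

/-- The radial majorant of the nonlinear term as a function of `ρ = |η|`: `ρ e^{-ρ}` survives from
the bilinear integrand, the other two factors from the time integral. -/
noncomputable def decayMajorant (γ y x ρ : ℝ) : ℝ :=
  ρ * Real.exp (-ρ) * (min 1 (ρ ^ (-γ)) ^ y * ρ ^ x)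

theorem decayMajorant_nonneg {γ y x ρ : ℝ} (hρ : 0 ≤ ρ) : 0 ≤ decayMajorant γ y x ρ := by
  unfold decayMajorant
  positivity

theorem measurable_decayMajorant (γ y x : ℝ) : Measurable (decayMajorant γ y x) := by
  unfold decayMajorant
  fun_prop

theorem exists_nonlinearMass_le {n : ℕ} (hn : 1 ≤ n) {p r m γ β : ℝ} (hp : 1 < p)
    (hpr : p ≤ r) (hl : singExp n < 2 + 1 / r - 2 / p)
    (he : 0 < n - 1 - m + (2 + 1 / r - 2 / p)) (hσ0 : n ≤ 2 * m) (hσ : 1 - 2 / p < 2 * m - n)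
    (hγ : 0 < γ) (hβ : 0 < β) :
    ∃ C : ℝ≥0, ∀ F : ℝ → ℝ≥0∞, Measurable F →
      ∀ ϑ : EuclideanSpace ℝ (Fin (n + 1)) → EuclideanSpace ℂ (Fin (n + 1)),
      (∀ᵐ x, ‖ϑ x‖ₑ ≤ ENNReal.ofReal (Real.exp (-‖x‖)) * F ‖x‖) → ∀ η ≠ 0,
      nonlinearMass γ β ϑ η ≤
        C * ENNReal.ofReal (decayMajorant γ (1 - 1 / r) (-(2 * m + 2 / p - (n + 1))) ‖η‖) *
          eLpNorm' (weightedProfile m F) p volume ^ 2 := by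
  obtain ⟨A, hA⟩ := exists_lintegral_exp_mul_radConv_le hn hp hpr hl he hσ0 hσ hγ
    (one_div_pos.2 hβ)
  obtain ⟨B, hB⟩ := exists_enorm_timeFactor_le (n + 1) γ (1 / β)
  refine ⟨B * 2 * A, fun F hF ϑ hϑF η hη => ?_⟩
  calc nonlinearMass γ β ϑ η
      ≤ ∫⁻ t in Ioc 1 (1 / β), B * ENNReal.ofReal (2 * (‖η‖ * Real.exp (-‖η‖))) *
          (ENNReal.ofReal (Real.exp (‖η‖ ^ γ * (1 - t ^ γ))) * radConv n F (‖η‖ * t)) := by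
        refine setLIntegral_mono' measurableSet_Ioc fun t ht => ?_
        simp only [enorm_smul]
        rw [lintegral_const_mul' _ _ enorm_ne_top, mul_mul_mul_comm]
        exact mul_le_mul' (hB η t (Ioc_subset_Icc_self ht))
          (lintegral_enorm_bilinearIntegrand_le hϑF η ht.1.le)
    _ ≤ B * ENNReal.ofReal (2 * (‖η‖ * Real.exp (-‖η‖))) *
          (A * ENNReal.ofReal (min 1 (‖η‖ ^ (-γ)) ^ (1 - 1 / r) *
            ‖η‖ ^ (-(2 * m + 2 / p - (n + 1)))) * eLpNorm' (weightedProfile m F) p volume ^ 2) := by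
        rw [lintegral_const_mul' _ _ (ENNReal.mul_ne_top ENNReal.coe_ne_top ENNReal.ofReal_ne_top)]
        exact mul_le_mul' le_rfl ((lintegral_mono_set Ioc_subset_Icc_self).trans
          (hA F hF ‖η‖ (norm_pos_iff.2 hη)))
    _ = _ := by
        rw [decayMajorant, ENNReal.ofReal_mul zero_le_two,
          ENNReal.ofReal_mul (p := ‖η‖ * _) (by positivity), ENNReal.ofReal_ofNat]
        push_cast
        ring

end PointwiseBounds

section Measurability

variable {d : ℕ} {ϑ : EuclideanSpace ℝ (Fin d) → EuclideanSpace ℂ (Fin d)}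

theorem measurable_dotC :
    Measurable fun q : EuclideanSpace ℝ (Fin d) × EuclideanSpace ℂ (Fin d) => dotC q.1 q.2 := by
  unfold dotC
  fun_prop

theorem measurable_leray :
    Measurable fun q : EuclideanSpace ℝ (Fin d) × EuclideanSpace ℂ (Fin d) => leray q.1 q.2 := by
  have := measurable_dotC (d := d)
  unfold leray
  fun_prop

theorem measurable_timeFactor_smul_bilinearIntegrand (hϑ : Measurable ϑ) (γ : ℝ) :
    Measurable fun q : (EuclideanSpace ℝ (Fin d) × ℝ) × EuclideanSpace ℝ (Fin d) =>
      timeFactor γ q.1.1 q.1.2 • bilinearIntegrand ϑ q.1.1 q.1.2 q.2 := by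
  have htime : Measurable fun q : (EuclideanSpace ℝ (Fin d) × ℝ) × EuclideanSpace ℝ (Fin d) =>
      timeFactor γ q.1.1 q.1.2 := by
    unfold timeFactor
    fun_prop
  have hdot : Measurable fun q : (EuclideanSpace ℝ (Fin d) × ℝ) × EuclideanSpace ℝ (Fin d) =>
      dotC q.1.1 (ϑ (q.1.2 • q.1.1 - q.2)) :=
    measurable_dotC.comp (measurable_fst.fst.prodMk (hϑ.comp (by fun_prop)))
  exact htime.smul (hdot.smul
    (measurable_leray.comp (measurable_fst.fst.prodMk (hϑ.comp measurable_snd))))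

theorem aestronglyMeasurable_timeFactor_smul_bilinearIntegrand
    (hϑ : AEStronglyMeasurable ϑ volume) (γ : ℝ) (η : EuclideanSpace ℝ (Fin d)) (τ : Measure ℝ)
    [SFinite τ] :
    AEStronglyMeasurable (fun q : ℝ × EuclideanSpace ℝ (Fin d) =>
      timeFactor γ η q.1 • bilinearIntegrand ϑ η q.1 q.2) (τ.prod volume) := by
  have hsub : Measure.QuasiMeasurePreserving
      (fun q : ℝ × EuclideanSpace ℝ (Fin d) => q.1 • η - q.2) (τ.prod volume) volume :=
    QuasiMeasurePreserving.prod_of_right (by fun_prop)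
      (.of_forall fun t => quasiMeasurePreserving_sub_left volume (t • η))
  obtain ⟨ϑ', hϑ', heq⟩ := hϑ
  have hm := (measurable_timeFactor_smul_bilinearIntegrand hϑ'.measurable γ).comp
    (by fun_prop : Measurable fun q : ℝ × EuclideanSpace ℝ (Fin d) => ((η, q.1), q.2))
  refine hm.aestronglyMeasurable.congr ?_
  filter_upwards [hsub.ae heq, Measure.quasiMeasurePreserving_snd.ae heq] with q hq hq'
  simp only [Function.comp_apply, bilinearIntegrand, hq, hq']

theorem stronglyMeasurable_renorm (hϑ : Measurable ϑ) (γ : ℝ) {β : ℝ} (hβ : 1 ≤ 1 / β) :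
    StronglyMeasurable (renorm γ β ϑ) := by
  have hnonlinear : StronglyMeasurable fun η : EuclideanSpace ℝ (Fin d) =>
      ∫ t in Ioc 1 (1 / β), ∫ x, timeFactor γ η t • bilinearIntegrand ϑ η t x :=
    (measurable_timeFactor_smul_bilinearIntegrand hϑ γ).stronglyMeasurable.integral_prod_right'
      |>.integral_prod_right'
  have hlinear : Measurable fun η : EuclideanSpace ℝ (Fin d) =>
      (β ^ cExp d γ * Real.exp (‖η‖ ^ γ * (1 - 1 / β ^ γ))) • ϑ ((1 / β) • η) := by
    fun_prop
  simp only [integral_smul] at hnonlinear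
  unfold renorm
  simp only [intervalIntegral.integral_of_le hβ]
  exact hlinear.stronglyMeasurable.add (hnonlinear.const_smul (Complex.I * (γ : ℂ)))

theorem aestronglyMeasurable_renorm (hϑ : AEStronglyMeasurable ϑ volume) (γ : ℝ) {β : ℝ}
    (hβ : 0 < β) (hβ1 : β < 1) : AEStronglyMeasurable (renorm γ β ϑ) volume := by
  obtain ⟨ϑ', hϑ', heq⟩ := hϑ
  exact ⟨_, stronglyMeasurable_renorm hϑ'.measurable γ (one_le_one_div hβ hβ1.le),
    renorm_congr_ae hβ heq⟩

theorem renormConvergesAt_of_nonlinearMass_lt_top (hϑ : AEStronglyMeasurable ϑ volume) {γ β : ℝ}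
    {η : EuclideanSpace ℝ (Fin d)} (h : nonlinearMass γ β ϑ η < ⊤) :
    RenormConvergesAt γ β ϑ η := by
  have hm := aestronglyMeasurable_timeFactor_smul_bilinearIntegrand hϑ γ η
    (volume.restrict (Ioc 1 (1 / β)))
  exact ⟨hm, by rwa [HasFiniteIntegral, lintegral_prod _ hm.enorm]⟩

theorem enorm_renorm_le (ϑ : EuclideanSpace ℝ (Fin d) → EuclideanSpace ℂ (Fin d)) {γ β : ℝ}
    (hγ : 0 ≤ γ) (hβ : 0 < β) (hβ1 : β < 1) (η : EuclideanSpace ℝ (Fin d)) :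
    ‖renorm γ β ϑ η‖ₑ ≤ ENNReal.ofReal (β ^ cExp d γ * ‖ϑ ((1 / β) • η)‖) +
      ENNReal.ofReal γ * nonlinearMass γ β ϑ η := by
  rw [renorm, intervalIntegral.integral_of_le (one_le_one_div hβ hβ1.le)]
  refine (enorm_add_le _ _).trans (add_le_add ?_ ?_)
  · have hexp : Real.exp (‖η‖ ^ γ * (1 - 1 / β ^ γ)) ≤ 1 := by
      rw [Real.exp_le_one_iff]
      refine mul_nonpos_of_nonneg_of_nonpos (by positivity) (sub_nonpos.2 ?_)
      exact one_le_one_div (by positivity) (Real.rpow_le_one hβ.le hβ1.le hγ)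
    rw [← ofReal_norm, norm_smul, Real.norm_of_nonneg (by positivity)]
    gcongr
    exact mul_le_of_le_one_right (by positivity) hexp
  · rw [enorm_smul, ← ofReal_norm, norm_mul, Complex.norm_I, one_mul, Complex.norm_real,
      Real.norm_of_nonneg hγ]
    gcongr
    refine (enorm_integral_le_lintegral_enorm _).trans (lintegral_mono fun t => ?_)
    rw [← integral_smul]
    exact enorm_integral_le_lintegral_enorm _

end Measurability

section RadialMajorant

theorem memLp_comp_const_smul {E G : Type*} [NormedAddCommGroup E] [NormedSpace ℝ E]
    [MeasurableSpace E] [BorelSpace E] [FiniteDimensional ℝ E] {μ : Measure E}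
    [μ.IsAddHaarMeasure] [NormedAddCommGroup G] {f : E → G} {p : ℝ≥0∞} (hf : MemLp f p μ) {R : ℝ}
    (hR : R ≠ 0) : MemLp (fun x => f (R • x)) p μ := by
  have hmap : MemLp f p (μ.map (R • ·)) := by
    rw [Measure.map_addHaar_smul μ hR]
    exact hf.smul_measure ENNReal.ofReal_ne_top
  exact hmap.comp_of_map (measurable_const_smul R).aemeasurable

theorem uWeight_nonneg {d : ℕ} (ν : ℝ) (x : EuclideanSpace ℝ (Fin d)) : 0 ≤ uWeight ν x := by
  unfold uWeight
  positivity

theorem measurable_uWeight {d : ℕ} (ν : ℝ) : Measurable (uWeight (d := d) ν) := by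
  unfold uWeight
  fun_prop

theorem uWeight_le_mul_uWeight_smul {d : ℕ} {R : ℝ} (hR : 1 ≤ R) (ν : ℝ)
    (η : EuclideanSpace ℝ (Fin d)) : uWeight ν η ≤ R ^ (-ν) * uWeight ν (R • η) := by
  have hR0 : 0 < R := one_pos.trans_le hR
  have hexp : Real.exp ‖η‖ ≤ Real.exp (R * ‖η‖) :=
    Real.exp_le_exp.2 (le_mul_of_one_le_left (norm_nonneg η) hR)
  unfold uWeight
  rw [norm_smul, Real.norm_of_nonneg hR0.le, Real.mul_rpow hR0.le (norm_nonneg _),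
    Real.rpow_neg hR0.le]
  calc _ ≤ Real.exp (R * ‖η‖) * ‖η‖ ^ ν := by gcongr
    _ = _ := by field_simp

theorem MemWeightedLp.memLp_uWeight_mul_norm_smul {d : ℕ} {ν p : ℝ}
    {g : EuclideanSpace ℝ (Fin d) → EuclideanSpace ℂ (Fin d)} (hg : MemWeightedLp (uWeight ν) p g)
    {R : ℝ} (hR : 1 ≤ R) :
    MemLp (fun η => uWeight ν η * ‖g (R • η)‖) (ENNReal.ofReal p) := by
  have hR0 : R ≠ 0 := (one_pos.trans_le hR).ne'
  have hgR : AEStronglyMeasurable (fun η => g (R • η)) :=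
    hg.1.comp_quasiMeasurePreserving (Measure.quasiMeasurePreserving_smul volume hR0)
  refine ((memLp_comp_const_smul hg.2 hR0).norm.const_mul (R ^ (-ν))).mono
    ((measurable_uWeight ν).aestronglyMeasurable.mul hgR.norm) (.of_forall fun η => ?_)
  refine le_trans (Eq.le ?_) ((mul_le_mul_of_nonneg_right (uWeight_le_mul_uWeight_smul hR ν η)
    (norm_nonneg (g (R • η)))).trans (Eq.trans_le ?_ (Real.le_norm_self _)))
  · exact Real.norm_of_nonneg (mul_nonneg (uWeight_nonneg ν η) (norm_nonneg _))
  · rw [norm_smul, Real.norm_of_nonneg (uWeight_nonneg ν _), mul_assoc]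

theorem memLp_uWeight_mul_decayMajorant {n : ℕ} {p x y γ ν : ℝ} (hp : 0 < p) (hy : 0 ≤ y)
    (h0 : 0 < n + 1 + p * (ν + 1 + x)) (h1 : n + 1 + p * (ν + 1 + x) < γ * p * y) :
    MemLp (fun η : EuclideanSpace ℝ (Fin (n + 1)) =>
      uWeight ν η * decayMajorant γ y x ‖η‖) (ENNReal.ofReal p) := by
  refine (memLp_congr_ae ?_).1 (memLp_min_rpow_mul_norm_rpow hp hy h0 h1)
  filter_upwards [Measure.ae_ne volume (0 : EuclideanSpace ℝ (Fin (n + 1)))] with η hη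
  have hη0 : 0 < ‖η‖ := norm_pos_iff.2 hη
  rw [uWeight, decayMajorant, Real.rpow_add hη0, Real.rpow_add hη0, Real.rpow_one, Real.exp_neg]
  field_simp

theorem mem_radiallyDominated_of_norm_le {d : ℕ} [NeZero d] {w : EuclideanSpace ℝ (Fin d) → ℝ}
    (hw : AEStronglyMeasurable w) {p : ℝ}
    {f : EuclideanSpace ℝ (Fin d) → EuclideanSpace ℂ (Fin d)} (hf : AEStronglyMeasurable f)
    {φ : EuclideanSpace ℝ (Fin d) → ℝ} (hφ : AEStronglyMeasurable φ)
    (hrad : ∀ x y, ‖x‖ = ‖y‖ → φ x = φ y) (hwφ : MemLp (fun x => w x * φ x) (ENNReal.ofReal p))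
    (h : ∀ᵐ x, ‖f x‖ ≤ ‖φ x‖) : f ∈ radiallyDominated w p := by
  have of_norm_le {g : EuclideanSpace ℝ (Fin d) → EuclideanSpace ℂ (Fin d)}
      (hg : AEStronglyMeasurable g) (hgφ : ∀ᵐ x, ‖g x‖ ≤ ‖φ x‖) : MemWeightedLp w p g := by
    refine ⟨hg, hwφ.mono (hw.smul hg) (hgφ.mono fun x hx => ?_)⟩
    rw [norm_smul, norm_mul]
    gcongr
  let e : EuclideanSpace ℂ (Fin d) := EuclideanSpace.single 0 1
  have hnorm (x) : ‖(φ x : ℂ) • e‖ = ‖φ x‖ := by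
    rw [norm_smul, Complex.norm_real, PiLp.norm_single, norm_one, mul_one]
  have hφe : AEStronglyMeasurable fun x => (φ x : ℂ) • e :=
    (Complex.continuous_ofReal.comp_aestronglyMeasurable hφ).smul_const e
  exact ⟨of_norm_le hf h, fun x => (φ x : ℂ) • e,
    of_norm_le hφe (.of_forall fun x => (hnorm x).le), fun x y hxy => by simp only [hrad x y hxy],
    by simpa only [hnorm] using h⟩

end RadialMajorant

section Invariance

theorem exists_nonlinearMass_le_of_mem_radiallyDominated {n : ℕ} (hn : 1 ≤ n) {p r ν γ β : ℝ}
    (hp : 1 < p) (hpr : p ≤ r) (hl : singExp n < 2 + 1 / r - 2 / p)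
    (he : 0 < n - 1 - (ν + n / p) + (2 + 1 / r - 2 / p)) (hσ0 : n ≤ 2 * (ν + n / p))
    (hσ : 1 - 2 / p < 2 * (ν + n / p) - n) (hγ : 0 < γ) (hβ : 0 < β)
    {ϑ : EuclideanSpace ℝ (Fin (n + 1)) → EuclideanSpace ℂ (Fin (n + 1))}
    (hϑ : ϑ ∈ radiallyDominated (uWeight ν) p) :
    ∃ K : ℝ≥0, ∀ᵐ η, nonlinearMass γ β ϑ η ≤ ENNReal.ofReal
      (K * decayMajorant γ (1 - 1 / r) (-(2 * (ν + n / p) + 2 / p - (n + 1))) ‖η‖) := by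
  obtain ⟨-, g, hg, hgrad, hϑg⟩ := hϑ
  obtain ⟨F, hF, hgF, hFp⟩ := exists_profile_of_memWeightedLp (by linarith) hg hgrad
  have hϑF : ∀ᵐ x, ‖ϑ x‖ₑ ≤ ENNReal.ofReal (Real.exp (-‖x‖)) * F ‖x‖ := by
    filter_upwards [hϑg, hgF] with x hx hgx
    exact hgx ▸ enorm_le_iff_norm_le.2 hx
  obtain ⟨C, hC⟩ := exists_nonlinearMass_le hn hp hpr hl he hσ0 hσ hγ hβ
  lift eLpNorm' (weightedProfile (ν + n / p) F) p volume to ℝ≥0 using hFp with N hN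
  refine ⟨C * N ^ 2, ?_⟩
  filter_upwards [Measure.ae_ne volume (0 : EuclideanSpace ℝ (Fin (n + 1)))] with η hη
  refine (hC F hF ϑ hϑF η hη).trans_eq ?_
  rw [← hN, ENNReal.ofReal_mul (by positivity), ENNReal.ofReal_coe_nnreal, mul_right_comm]
  push_cast
  rfl

theorem renorm_mem_radiallyDominated_of_nonlinearMass_le {d : ℕ} [NeZero d] {ν p γ β : ℝ}
    (hγ : 0 ≤ γ) (hβ : 0 < β) (hβ1 : β < 1)
    {ϑ : EuclideanSpace ℝ (Fin d) → EuclideanSpace ℂ (Fin d)}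
    (hϑ : ϑ ∈ radiallyDominated (uWeight ν) p) {ψ : ℝ → ℝ} (hψ : Measurable ψ)
    (hψ0 : ∀ ρ, 0 ≤ ρ → 0 ≤ ψ ρ)
    (hψp : MemLp (fun η : EuclideanSpace ℝ (Fin d) => uWeight ν η * ψ ‖η‖) (ENNReal.ofReal p))
    (hmass : ∀ᵐ η, nonlinearMass γ β ϑ η ≤ ENNReal.ofReal (ψ ‖η‖)) :
    renorm γ β ϑ ∈ radiallyDominated (uWeight ν) p := by
  obtain ⟨hϑm, g, hg, hgrad, hϑg⟩ := hϑ
  have hdilate : Measure.QuasiMeasurePreserving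
      (fun η : EuclideanSpace ℝ (Fin d) => (1 / β) • η) volume volume :=
    Measure.quasiMeasurePreserving_smul volume (one_div_pos.2 hβ).ne'
  set b : ℝ := β ^ cExp d γ
  refine mem_radiallyDominated_of_norm_le (measurable_uWeight ν).aestronglyMeasurable
    (aestronglyMeasurable_renorm hϑm.1 γ hβ hβ1)
    (φ := fun η => b * ‖g ((1 / β) • η)‖ + γ * ψ ‖η‖)
    (((hg.1.comp_quasiMeasurePreserving hdilate).norm.const_mul b).add
      (hψ.comp measurable_norm |>.const_mul γ).aestronglyMeasurable) ?_ ?_ ?_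
  · intro η η' h
    simp only [h, hgrad ((1 / β) • η) ((1 / β) • η') (by rw [norm_smul, norm_smul, h])]
  · have hlinear := (hg.memLp_uWeight_mul_norm_smul (one_le_one_div hβ hβ1.le)).const_mul b
    exact (memLp_congr_ae (.of_forall fun η => by simp only [Pi.add_apply]; ring)).1
      (hlinear.add (hψp.const_mul γ))
  · filter_upwards [hmass, hdilate.ae hϑg] with η hη hϑgη
    have hψη := hψ0 ‖η‖ (norm_nonneg η)
    refine le_trans ?_ (Real.le_norm_self _)
    rw [← ENNReal.ofReal_le_ofReal_iff (by positivity), ofReal_norm,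
      ENNReal.ofReal_add (by positivity) (by positivity), ENNReal.ofReal_mul hγ]
    exact (enorm_renorm_le ϑ hγ hβ hβ1 η).trans (by gcongr)

theorem exists_exponent_of_le {D P X Y ν : ℝ} (hP : 0 < P) (hX : 0 < X) (hXY : X < Y)
    (hνP : ν < D + P) (hνX : ν ≤ D + X) : ∃ x, 0 < x ∧ x ≤ P ∧ x < Y ∧ ν < D + x := by
  rcases le_or_gt P X with hPX | hXP
  · exact ⟨P, hP, le_rfl, hPX.trans_lt hXY, hνP⟩
  · obtain ⟨x, hXx, hx⟩ := exists_between (lt_min hXP hXY)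
    obtain ⟨hxP, hxY⟩ := lt_min_iff.1 hx
    exact ⟨x, hX.trans hXx, hxP.le, hxY, by linarith⟩

theorem singExp_lt_of_lt {n : ℕ} {P x ν : ℝ} (hP : P < 1) (hx : 0 < x)
    (hν : (n : ℝ) / 2 * (1 - 2 * P) < ν) (hνx : ν < (n + 1) - (n + 2) * P + x) :
    singExp n < 2 + x - 2 * P := by
  unfold singExp
  split_ifs with h
  · subst h
    rw [Nat.cast_one] at hν hνx
    linarith
  · linarith

theorem exists_admissible_exponent {n : ℕ} {γ p r ν E : ℝ} (hp : 1 < p) (hr : 1 < r)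
    (hν₁ : (n : ℝ) / 2 * (1 - 2 / p) < ν) (hν₂ : ν < ((n : ℝ) + 1) * ((p - 1) / p))
    (hν₃ : ν ≤ (n + 1) - (n + 2) / p + 1 / r) (hγ : 0 < γ) (hE : E < γ * p * (1 - 1 / r)) :
    ∃ r₁ : ℝ, p ≤ r₁ ∧ singExp n < 2 + 1 / r₁ - 2 / p ∧
      0 < n - 1 - (ν + n / p) + (2 + 1 / r₁ - 2 / p) ∧ E < γ * p * (1 - 1 / r₁) := by
  have hp0 : 0 < p := by linarith
  have hγp : 0 < γ * p := by positivity
  have hXY : 1 / r < 1 - E / (γ * p) := by rwa [lt_sub_comm, div_lt_iff₀' hγp]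
  have hν₂' : ν < (n + 1) - (n + 2) / p + 1 / p := by
    refine hν₂.trans_eq ?_
    field_simp
    ring
  obtain ⟨x, hx0, hxp, hxY, hνx⟩ :=
    exists_exponent_of_le (one_div_pos.2 hp0) (by positivity) hXY hν₂' hν₃
  refine ⟨1 / x, (le_one_div hp0 hx0).2 hxp, ?_⟩
  rw [one_div_one_div]
  rw [div_eq_mul_one_div 2 p] at hν₁ ⊢
  rw [div_eq_mul_one_div _ p] at hνx
  rw [div_eq_mul_one_div (n : ℝ) p]
  refine ⟨singExp_lt_of_lt ((div_lt_one hp0).2 hp) hx0 hν₁ hνx, by linarith, ?_⟩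
  rwa [lt_sub_comm, div_lt_iff₀' hγp] at hxY

theorem div_sub_eq_of_scaling {n p r ν κ : ℝ} (hn : 0 ≤ n)
    (hscale : 1 / r = 2 / p + (2 * ν + κ) / (n + 1) - 1) :
    (n + 1) / r - κ = 2 * (ν + n / p) + 2 / p - (n + 1) := by
  rw [div_eq_mul_one_div, hscale]
  field_simp
  ring

theorem mul_sub_div_add_eq {D p r ν κ k : ℝ} (hr : r ≠ 0) (hk : D / r - κ = k) :
    D * (r - p) / r + p * (ν + κ + 1) = D + p * (ν + 1 + -k) := by
  rw [← hk]
  field_simp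
  ring

theorem renorm_mem_radiallyDominated {n : ℕ} (hn : 1 ≤ n) {p r ν γ β : ℝ} (hp : 1 < p)
    (hpr : p ≤ r) (hl : singExp n < 2 + 1 / r - 2 / p)
    (he : 0 < n - 1 - (ν + n / p) + (2 + 1 / r - 2 / p)) (hσ0 : n ≤ 2 * (ν + n / p))
    (hσ : 1 - 2 / p < 2 * (ν + n / p) - n) (hγ : 0 < γ) (hβ : 0 < β) (hβ1 : β < 1)
    (hlow : 0 < n + 1 + p * (ν + 1 + -(2 * (ν + n / p) + 2 / p - (n + 1))))
    (hupp : n + 1 + p * (ν + 1 + -(2 * (ν + n / p) + 2 / p - (n + 1))) < γ * p * (1 - 1 / r))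
    {ϑ : EuclideanSpace ℝ (Fin (n + 1)) → EuclideanSpace ℂ (Fin (n + 1))}
    (hϑ : ϑ ∈ radiallyDominated (uWeight ν) p) :
    (∀ᵐ η, RenormConvergesAt γ β ϑ η) ∧ renorm γ β ϑ ∈ radiallyDominated (uWeight ν) p := by
  have hr : 1 ≤ r := by linarith
  have hr' : 0 ≤ 1 - 1 / r := sub_nonneg.2 ((div_le_one (by linarith)).2 hr)
  obtain ⟨K, hK⟩ := exists_nonlinearMass_le_of_mem_radiallyDominated hn hp hpr hl he hσ0 hσ hγ hβ hϑ
  refine ⟨hK.mono fun η hη =>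
    renormConvergesAt_of_nonlinearMass_lt_top hϑ.1.1 (hη.trans_lt ENNReal.ofReal_lt_top), ?_⟩
  refine renorm_mem_radiallyDominated_of_nonlinearMass_le hγ.le hβ hβ1 hϑ
    ((measurable_decayMajorant _ _ _).const_mul (K : ℝ))
    (fun ρ hρ => mul_nonneg K.2 (decayMajorant_nonneg hρ)) ?_ hK
  simp only [mul_left_comm _ (K : ℝ)]
  exact (memLp_uWeight_mul_decayMajorant (by linarith) hr' hlow hupp).const_mul (K : ℝ)

end Invariance

end NSRenorm

theorem mainTheorem7_general (d : ℕ) (hd : 2 ≤ d) (γ p r ν κ : ℝ)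
    (hp : 1 < p) (hr : 1 < r)
    (hscale : 1 / r = 2 / p + (2 * ν + κ) / (d : ℝ) - 1)
    (hκ : κ < (d : ℝ) / r)
    (hν₁ : ((d : ℝ) - 1) / 2 * (1 - 2 / p) < ν)
    (hν₂ : ν < (d : ℝ) * ((p - 1) / p))
    (hνκ : ((d : ℝ) - 1) * (1 / r - 1 / p) ≤ ν + κ)
    (hlow : 0 < (d : ℝ) * (r - p) / r + p * (ν + κ + 1))
    (hupp : (d : ℝ) * (r - p) / r + p * (ν + κ + 1) < γ * p * (r - 1) / r) :
    ∀ β : ℝ, 0 < β → β < 1 →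
      ∀ ϑ ∈ NSRenorm.radiallyDominated (d := d) (NSRenorm.uWeight ν) p,
        (∀ᵐ η ∂(volume : Measure (EuclideanSpace ℝ (Fin d))), NSRenorm.RenormConvergesAt γ β ϑ η) ∧
        NSRenorm.renorm γ β ϑ ∈ NSRenorm.radiallyDominated (d := d) (NSRenorm.uWeight ν) p := by
  intro β hβ hβ1 ϑ hϑ
  obtain ⟨n, rfl⟩ : ∃ n, d = n + 1 := ⟨d - 1, by lia⟩
  rw [Nat.cast_succ] at hscale hκ hν₁ hν₂ hνκ hlow hupp
  rw [add_sub_cancel_right] at hν₁ hνκ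
  have hp0 : 0 < p := by linarith
  have hr0 : 0 < r := by linarith
  have hdecay := NSRenorm.div_sub_eq_of_scaling n.cast_nonneg hscale
  rw [NSRenorm.mul_sub_div_add_eq hr0.ne' hdecay] at hlow hupp
  rw [mul_div_assoc, sub_div, div_self hr0.ne'] at hupp
  have hr1 : 0 < 1 - 1 / r := sub_pos.2 ((div_lt_one hr0).2 hr)
  have hγ : 0 < γ := pos_of_mul_pos_left (pos_of_mul_pos_left (hlow.trans hupp) hr1.le) hp0.le
  have hν₃ : ν ≤ (n + 1) - (n + 2) / p + 1 / r := by
    ring_nf at hνκ hdecay ⊢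
    linarith
  have hσ0 : (n : ℝ) ≤ 2 * (ν + n / p) := by
    ring_nf at hν₁ ⊢
    linarith
  obtain ⟨r₁, hpr, hl, he, hupp₁⟩ :=
    NSRenorm.exists_admissible_exponent hp hr hν₁ hν₂ hν₃ hγ hupp
  exact NSRenorm.renorm_mem_radiallyDominated (by lia) hp hpr hl he hσ0 (by linarith) hγ hβ hβ1
    hlow hupp₁ hϑ

theorem mainTheorem7 (d : ℕ) (hd : 2 ≤ d) (γ p r ν κ : ℝ)
    (hp : 1 < p) (hr : 1 < r)
    (hscale : 1 / r = 2 / p + (2 * ν + κ) / (d : ℝ) - 1)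
    (hκ : κ < (d : ℝ) / r)
    (hν₁ : ((d : ℝ) - 1) / 2 * (1 - 2 / p) < ν)
    (hν₂ : ν < (d : ℝ) * ((p - 1) / p))
    (hrp : p ≤ 2 * r)
    (hmax : 0 < max ν κ)
    (hνκ : ((d : ℝ) - 1) * (1 / r - 1 / p) ≤ ν + κ)
    (hlow : max 0 ((d : ℝ) + p * (NSRenorm.cExp d γ + ν)) <
      (d : ℝ) * (r - p) / r + p * (ν + κ + 1))
    (hupp : (d : ℝ) * (r - p) / r + p * (ν + κ + 1) < γ * p * (r - 1) / r) :
    ∀ β : ℝ, 0 < β → β < 1 →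
      ∀ ϑ ∈ NSRenorm.radiallyDominated (d := d) (NSRenorm.uWeight ν) p,
        (∀ᵐ η ∂(MeasureTheory.volume : MeasureTheory.Measure (EuclideanSpace ℝ (Fin d))),
          NSRenorm.RenormConvergesAt γ β ϑ η) ∧
        NSRenorm.renorm γ β ϑ ∈
          NSRenorm.radiallyDominated (d := d) (NSRenorm.uWeight ν) p :=
  mainTheorem7_general d hd γ p r ν κ hp hr hscale hκ hν₁ hν₂ hνκ
    ((le_max_left _ _).trans_lt hlow) hupp
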